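/- For a Coxeter system $(W,S)$ with identity $e$, length function $\ell$ and set of reflections $T=\{vsv^{-1}: s\in S, v\in W\}$, write $a\to b$ if $b=ta$ for some $t\in T$ and $\ell(a)<\ell(b)$. The Bruhat order is the partial order given by $a\le b$ if there is a chain $a=w_0\to w_1\to\cdots\to w_k=b$ with $k\ge 0$, and $[a,b]=\{y: a\le y\le b\}$ is regarded as a poset with the induced order. For $v\in[a,b]$, let $\deg_{a,b}(v)$ be the number of $v'\in[a,b]$ with $v\to v'$ or $v'\to v$, i.e. the degree of $v$ in the (undirected) Bruhat graph of $[a,b]$. Let $W$ be a Weyl group (the Weyl group of a finite reduced crystallographic root system), with $S$ the set of reflections in the roots of a base, and let $u<w$ in $W$. The interval $[u,w]$ is called rationally smooth if $\deg_{y,w}(y)=\ell(w)-\ell(y)$ for all $y\in[u,w]$ (by a theorem of Carrell and Peterson, this is equivalent to the Schubert variety $X(w)$ being rationally smooth at a point corresponding to $u$). Proposition. If the dual poset $[u,w]^{*}$ is isomorphic, as a poset, to a lower Bruhat interval $[e,x]$ in some Coxeter system $(W',S')$, possibly different from $(W,S)$, then $[u,w]$ is rationally smooth. -/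

import Mathlib

namespace CoxeterSystem

variable {B W : Type*} [Group W] {M : CoxeterMatrix B} (cs : CoxeterSystem M W)

/-- `(W, S)` is a Weyl group with its simple reflections: it is the Weyl group of a (reduced,
crystallographic, finite) root system, and the elements of `S` are the reflections in the roots
of a base. These are the Weyl groups of semisimple complex algebraic groups. (The root system may
be empty; then `W` is trivial.) -/
def IsWeyl : Prop :=
  ∃ (ι V V' : Type) (_ : Finite ι) (_ : AddCommGroup V) (_ : Module ℝ V)
    (_ : AddCommGroup V') (_ : Module ℝ V') (P : RootPairing ι ℝ V V')
    (_ : P.IsRootSystem) (_ : P.IsCrystallographic) (_ : P.IsReduced) (b : P.Base)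
    (f : B ≃ b.support) (φ : W ≃* P.weylGroup),
    ∀ i : B, φ (cs.simple i) = RootPairing.weylGroup.ofIdx P (f i)

/-- `u → w`: there is a reflection `t` with `w = t u`, and `ℓ(u) < ℓ(w)`. -/
def BruhatStep (u w : W) : Prop :=
  (∃ t, cs.IsReflection t ∧ w = t * u) ∧ cs.length u < cs.length w

/-- The Bruhat order: there is a chain `u = w₀ → w₁ → ⋯ → wₖ = w`, with `k ≥ 0`. -/
def BruhatLE (u w : W) : Prop := Relation.ReflTransGen cs.BruhatStep u w

/-- The strict Bruhat order. -/
def BruhatLT (u w : W) : Prop := cs.BruhatLE u w ∧ u ≠ w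

variable {cs} in
theorem BruhatLE.eq_or_length_lt {u w : W} (h : cs.BruhatLE u w) :
    u = w ∨ cs.length u < cs.length w := by
  unfold BruhatLE at h
  induction h with
  | refl => exact Or.inl rfl
  | tail _ hs ih =>
    rcases ih with rfl | ih
    · exact Or.inr hs.2
    · exact Or.inr (ih.trans hs.2)

theorem BruhatLE.refl (u : W) : cs.BruhatLE u u := Relation.ReflTransGen.refl

variable {cs} in
theorem BruhatLE.trans {u v w : W} (h : cs.BruhatLE u v) (h' : cs.BruhatLE v w) :
    cs.BruhatLE u w := Relation.ReflTransGen.trans h h'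

variable {cs} in
theorem BruhatLE.antisymm {u w : W} (h : cs.BruhatLE u w) (h' : cs.BruhatLE w u) : u = w := by
  rcases h.eq_or_length_lt with rfl | h1
  · rfl
  · rcases h'.eq_or_length_lt with rfl | h2
    · rfl
    · exact absurd h2 (not_lt.mpr h1.le)

/-- The Bruhat interval `[u, w] = {y | u ≤ y ≤ w}`. -/
@[ext]
structure BruhatInterval (u w : W) where
  /-- the underlying element of `W` -/
  val : W
  left_le : cs.BruhatLE u val
  le_right : cs.BruhatLE val w

/-- The Bruhat interval as a poset, with the order induced by the Bruhat order. -/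
instance (u w : W) : PartialOrder (cs.BruhatInterval u w) where
  le x y := cs.BruhatLE x.val y.val
  le_refl x := BruhatLE.refl cs x.val
  le_trans _ _ _ h h' := h.trans h'
  le_antisymm _ _ h h' := BruhatInterval.ext (h.antisymm h')

/-- The (undirected) Bruhat graph of `(W, S)`. -/
def bruhatGraph : SimpleGraph W where
  Adj u v := cs.BruhatStep u v ∨ cs.BruhatStep v u
  symm := ⟨fun _ _ h => h.symm⟩
  loopless := ⟨fun _ h => h.elim (fun h => lt_irrefl _ h.2) (fun h => lt_irrefl _ h.2)⟩

/-- The Bruhat graph of `[u, w]`: the subgraph of the Bruhat graph induced by `[u, w]`. -/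
def intervalBruhatGraph (u w : W) : SimpleGraph (cs.BruhatInterval u w) :=
  cs.bruhatGraph.comap BruhatInterval.val

/-- `deg_{u,w}(v)`: the degree of the vertex `v` in the Bruhat graph of `[u, w]`. -/
noncomputable def bruhatDegree (u w : W) (v : cs.BruhatInterval u w) : ℕ :=
  ((cs.intervalBruhatGraph u w).neighborSet v).ncard

/-- `[u, w]` is rationally smooth: `deg_{y,w}(y) = ℓ(w) - ℓ(y)` for all `y ∈ [u, w]`. -/
def IsRationallySmooth (u w : W) : Prop :=
  ∀ y : cs.BruhatInterval u w,
    (cs.bruhatDegree y.val w ⟨y.val, BruhatLE.refl cs y.val, y.le_right⟩ : ℤ) =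
      (cs.length w : ℤ) - (cs.length y.val : ℤ)

end CoxeterSystem

/-! The Bruhat graph of an interval can be recovered from its poset structure, so an
anti-isomorphism from `[u,w]` onto `[1,x]` reverses edges as well as order; it also turns colength
into length (`length_add_of_antiEquiv`). All edges at `y` inside `[y,w]` go up from `y`. They
correspond to the edges arriving at the image `y'` of `y`, and no such edge is lost, since a lower
interval contains everything below its members. In any Coxeter group exactly `ℓ(y')` edges arrive at
`y'`, one per inversion (`ncard_setOf_bruhatStep`), and `ℓ(y') = ℓ(w) - ℓ(y)`.

To recover the edges, note that an edge has odd length gap. A gap of one is a covering, visible in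
the order. An edge of gap at least three closes a hexagon of edges `x → a, a' → b, b' → y`, with
both `a`'s joined to both `b`'s (`BruhatStep.exists_hexagon`); conversely every such hexagon forces
an edge `x → y` (`bruhatStep_of_hexagon`). The configuration is symmetric under reversal and its
other edges have smaller gap, so induction on the gap applies (`BruhatStep.of_antiEquiv`).

Both hexagon statements live in dihedral reflection subgroups, described by the roots in a plane.
There a product of three reflections is again a reflection (`exists_rootReflection_eq_mul_mul`), the
positive roots lie in the cone of two simple ones (`exists_simple_pair`), and counting inversions
within the plane decides the direction of edges. All this rests on the geometric representation and
on each root being positive or negative. The representation space is enlarged so that distinct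
positive roots also give independent functionals, which may fail on the span of the simple roots
when the form is degenerate. -/

open Module Polynomial.Chebyshev

/-! ### The geometric representation -/

namespace CoxeterMatrix

variable {B : Type*} (M : CoxeterMatrix B)

/-- The space of the geometric representation: the span of the simple roots (the left summand),
enlarged by a space paired with it, so that distinct roots have independent coroots. -/
abbrev RootSpace (_ : CoxeterMatrix B) : Type _ := (B ⊕ B) →₀ ℝ

/-- The Gram matrix of the standard form on the root space. -/
noncomputable def gram : B ⊕ B → B ⊕ B → ℝ := by
  classical
  exact fun
  | .inl i, .inl j => -Real.cos (Real.pi / M i j)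
  | .inl i, .inr j => if i = j then 1 else 0
  | .inr i, .inl j => if i = j then 1 else 0
  | .inr _, .inr _ => 0

/-- The standard symmetric bilinear form on the root space. -/
noncomputable def form : M.RootSpace →ₗ[ℝ] M.RootSpace →ₗ[ℝ] ℝ :=
  Finsupp.linearCombination ℝ fun i => Finsupp.linearCombination ℝ fun j => M.gram i j

/-- The simple roots. -/
noncomputable def simpleRoot (i : B) : M.RootSpace := Finsupp.single (.inl i) 1

theorem gram_symm (i j : B ⊕ B) : M.gram i j = M.gram j i := by
  rcases i with i | i <;> rcases j with j | j <;> simp only [gram, M.symmetric i j]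
  all_goals split_ifs <;> simp_all

theorem form_symm (x y : M.RootSpace) : M.form x y = M.form y x := by
  have : M.form = M.form.flip := by
    ext i j
    simp [form, M.gram_symm i j]
  exact congrArg (fun f => f x y) this

theorem form_simpleRoot (i j : B) :
    M.form (M.simpleRoot i) (M.simpleRoot j) = -Real.cos (Real.pi / M i j) := by
  simp [form, simpleRoot, gram]

theorem form_simpleRoot_self (i : B) : M.form (M.simpleRoot i) (M.simpleRoot i) = 1 := by
  simp [form_simpleRoot]

/-- The auxiliary basis vectors act as coordinate functionals through the form; this is what makes
functionals of non-proportional roots independent. -/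
theorem form_single_inr (x : M.RootSpace) (i : B) :
    M.form (Finsupp.single (.inr i) 1) x = x (.inl i) := by
  classical
  simp only [form, Finsupp.linearCombination_single, one_smul]
  rw [Finsupp.linearCombination_apply, Finsupp.sum, Finset.sum_eq_single (.inl i)]
  · simp [gram]
  · rintro (j | j) _ h
    · have : i ≠ j := fun h' => h (h' ▸ rfl)
      simp [gram, this]
    · simp [gram]
  · intro h
    simp [Finsupp.notMem_support_iff.mp h]

/-- The orthogonal reflection in a vector of norm `1`. -/
noncomputable def orthRefl (d : M.RootSpace) (hd : M.form d d = 1) :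
    M.RootSpace ≃ₗ[ℝ] M.RootSpace :=
  Module.reflection (x := d) (f := (2 : ℝ) • M.form d) (by simp [hd])

theorem orthRefl_apply {d : M.RootSpace} (hd : M.form d d = 1) (v : M.RootSpace) :
    M.orthRefl d hd v = v - (2 * M.form d v) • d := by
  simp [orthRefl, Module.reflection_apply]

theorem form_orthRefl {d : M.RootSpace} (hd : M.form d d = 1) (v v' : M.RootSpace) :
    M.form (M.orthRefl d hd v) (M.orthRefl d hd v') = M.form v v' := by
  simp only [orthRefl_apply, map_sub, map_smul, LinearMap.sub_apply, LinearMap.smul_apply,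
    smul_eq_mul, hd, M.form_symm v d]
  ring

/-- With `θ = π/m`, these values times `sin 2θ` are `sin π`, respectively `sin (π + θ) + sin (π -
θ)`. The bound on `m` makes `sin 2θ` nonzero. -/
theorem S_eval_two_mul_cos_eq_zero {m : ℕ} (hm : 3 ≤ m) :
    let t : ℝ := 2 * Real.cos (2 * (Real.pi / m))
    (∀ k : ℤ, (m : ℤ) = 2 * k → (S ℝ (k - 1)).eval t = 0) ∧
    (∀ k : ℤ, (m : ℤ) = 2 * k + 1 → (S ℝ k).eval t + (S ℝ (k - 1)).eval t = 0) := by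
  intro t
  have hm0 : (0 : ℝ) < m := by exact_mod_cast (by omega : 0 < m)
  have hm3 : (3 : ℝ) ≤ m := by exact_mod_cast hm
  have hθ : (m : ℝ) * (Real.pi / m) = Real.pi := by field_simp
  set θ := Real.pi / m
  have hθ0 : 0 < θ := by positivity
  have hs : 0 < Real.sin (2 * θ) := by
    apply Real.sin_pos_of_pos_of_lt_pi (by positivity)
    nlinarith
  constructor
  · intro k hk
    have h := S_two_mul_real_cos (2 * θ) (k - 1)
    have : ((k - 1 : ℤ) + 1 : ℝ) * (2 * θ) = Real.pi := by
      rw [← hθ]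
      have : (m : ℝ) = 2 * k := by exact_mod_cast hk
      rw [this]; push_cast; ring
    rw [this, Real.sin_pi] at h
    exact (mul_eq_zero.mp h).resolve_right hs.ne'
  · intro k hk
    have h1 := S_two_mul_real_cos (2 * θ) k
    have h2 := S_two_mul_real_cos (2 * θ) (k - 1)
    have hk' : (m : ℝ) = 2 * k + 1 := by exact_mod_cast hk
    have e1 : ((k : ℝ) + 1) * (2 * θ) = Real.pi + θ := by rw [← hθ, hk']; ring
    have e2 : ((k - 1 : ℤ) + 1 : ℝ) * (2 * θ) = Real.pi - θ := by
      rw [← hθ, hk']; push_cast; ring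
    rw [e1] at h1
    rw [e2] at h2
    have : ((S ℝ k).eval t + (S ℝ (k - 1)).eval t) * Real.sin (2 * θ) = 0 := by
      rw [add_mul, h1, h2, Real.sin_pi_sub, add_comm Real.pi, Real.sin_add_pi]
      ring
    exact (mul_eq_zero.mp this).resolve_right hs.ne'

theorem isLiftable_orthRefl :
    M.IsLiftable fun i => M.orthRefl (M.simpleRoot i) (M.form_simpleRoot_self i) := by
  intro i j
  by_cases hij : i = j
  · subst hij
    ext1 z
    simp only [M.diagonal, pow_one, LinearEquiv.mul_apply, orthRefl_apply, map_sub, map_smul,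
      form_simpleRoot_self, LinearEquiv.coe_one, id]
    module
  have h1 := M.off_diagonal i j hij
  have hc := M.form_simpleRoot i j
  have hc' := M.form_simpleRoot j i
  rw [M.symmetric j i] at hc'
  generalize M i j = m at *
  rcases Nat.lt_or_ge m 3 with hm | hm
  · interval_cases m
    · simp
    · exact absurd rfl h1
    · ext1 z
      simp only [Nat.cast_ofNat, Real.cos_pi_div_two, neg_zero] at hc hc'
      simp only [pow_two, LinearEquiv.mul_apply, orthRefl_apply, map_sub, map_smul, hc, hc',
        form_simpleRoot_self, LinearEquiv.coe_one, id]
      module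
  · ext1 z
    have ht : 2 * Real.cos (2 * (Real.pi / m)) =
        ((2 : ℝ) • M.form (M.simpleRoot i)) (M.simpleRoot j) *
          ((2 : ℝ) • M.form (M.simpleRoot j)) (M.simpleRoot i) - 2 := by
      simp only [LinearMap.smul_apply, hc, hc', smul_eq_mul, Real.cos_two_mul]
      ring
    have key := Module.reflection_mul_reflection_pow_apply
      (x := M.simpleRoot i) (y := M.simpleRoot j) (f := (2 : ℝ) • M.form (M.simpleRoot i))
      (g := (2 : ℝ) • M.form (M.simpleRoot j)) (by simp [form_simpleRoot_self])
      (by simp [form_simpleRoot_self]) m z _ ht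
    obtain ⟨hS1, hS2⟩ := S_eval_two_mul_cos_eq_zero hm
    refine Eq.trans key ?_
    rw [LinearEquiv.coe_one, id]
    -- Each correction term in the formula for the `m`-th power contains the factor `S (k-1)` when
    -- `m = 2k`, and `S k + S (k-1)` when `m = 2k+1`.
    rcases Int.even_or_odd' (m : ℤ) with ⟨k, hk | hk⟩
    · rw [show ((m : ℤ) - 2) / 2 = k - 1 by omega, show ((m : ℤ) - 1) / 2 = k - 1 by omega,
        hS1 k hk]
      simp
    · rw [show ((m : ℤ) - 3) / 2 = k - 1 by omega, show ((m : ℤ) - 1) / 2 = k by omega,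
        show ((m : ℤ) - 2) / 2 = k - 1 by omega, show (m : ℤ) / 2 = k by omega, hS2 k hk]
      simp

end CoxeterMatrix

/-! ### Positivity of roots in the geometric representation. -/

namespace CoxeterSystem

variable {B W : Type*} [Group W] {M : CoxeterMatrix B} (cs : CoxeterSystem M W)

/-- The geometric representation of a Coxeter group. -/
noncomputable def geomRep : W →* (M.RootSpace ≃ₗ[ℝ] M.RootSpace) :=
  cs.lift ⟨_, M.isLiftable_orthRefl⟩

theorem geomRep_simple (i : B) :
    cs.geomRep (cs.simple i) = M.orthRefl (M.simpleRoot i) (M.form_simpleRoot_self i) :=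
  cs.lift_apply_simple M.isLiftable_orthRefl i

theorem geomRep_simple_apply (i : B) (v : M.RootSpace) :
    cs.geomRep (cs.simple i) v = v - (2 * M.form (M.simpleRoot i) v) • M.simpleRoot i := by
  rw [geomRep_simple, M.orthRefl_apply]

theorem geomRep_simple_simpleRoot (i : B) :
    cs.geomRep (cs.simple i) (M.simpleRoot i) = -M.simpleRoot i := by
  rw [geomRep_simple_apply, M.form_simpleRoot_self]
  module

theorem geomRep_mul_apply (w w' : W) (v : M.RootSpace) :
    cs.geomRep (w * w') v = cs.geomRep w (cs.geomRep w' v) := by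
  rw [map_mul, LinearEquiv.mul_apply]

theorem form_geomRep (w : W) (v v' : M.RootSpace) :
    M.form (cs.geomRep w v) (cs.geomRep w v') = M.form v v' := by
  induction w using cs.simple_induction_left generalizing v v' with
  | one => simp
  | mul_simple_left w i ih =>
    rw [geomRep_mul_apply, geomRep_mul_apply, geomRep_simple, M.form_orthRefl, ih]

theorem geomRep_apply_inr (w : W) (v : M.RootSpace) (i : B) :
    cs.geomRep w v (.inr i) = v (.inr i) := by
  induction w using cs.simple_induction_left with
  | one => simp
  | mul_simple_left w j ih =>
    rw [geomRep_mul_apply, geomRep_simple_apply]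
    simp [CoxeterMatrix.simpleRoot, ih]

/-- The coefficients of an alternating product applied to a simple root. -/
theorem geomRep_alternatingWord_apply (i j : B) (k : ℕ) :
    cs.geomRep (cs.wordProd (alternatingWord i j k)) (M.simpleRoot i) =
      (if Even k then (U ℝ k).eval (Real.cos (Real.pi / M i j))
        else (U ℝ (k - 1)).eval (Real.cos (Real.pi / M i j))) • M.simpleRoot i +
      (if Even k then (U ℝ (k - 1)).eval (Real.cos (Real.pi / M i j))
        else (U ℝ k).eval (Real.cos (Real.pi / M i j))) • M.simpleRoot j := by
  have hij := M.form_simpleRoot i j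
  have hji := M.form_simpleRoot j i
  rw [M.symmetric j i] at hji
  set c := Real.cos (Real.pi / M i j)
  induction k with
  | zero => simp [alternatingWord]
  | succ k ih =>
    have hU : (U ℝ ((k + 1 : ℕ) : ℤ)).eval c =
        2 * c * (U ℝ k).eval c - (U ℝ (k - 1)).eval c := by
      have := congrArg (Polynomial.eval c) (U_add_one ℝ k)
      simpa using this
    have hU' : (U ℝ (((k + 1 : ℕ) : ℤ) - 1)).eval c = (U ℝ k).eval c := by simp
    rw [alternatingWord_succ', wordProd_cons, geomRep_mul_apply, ih, hU, hU']
    by_cases hk : Even k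
    · have hk' : ¬ Even (k + 1) := by simpa [Nat.even_add_one] using hk
      simp only [hk, hk', if_true, if_false, geomRep_simple_apply, map_add, map_smul,
        hji, M.form_simpleRoot_self]
      module
    · have hk' : Even (k + 1) := by simpa [Nat.even_add_one] using hk
      simp only [hk, hk', if_true, if_false, geomRep_simple_apply, map_add, map_smul,
        hij, M.form_simpleRoot_self]
      module

/-- The value is `sin (kθ) / sin θ` with `θ = π/m` and `kθ ≤ π`. The case `m = 0` encodes infinite
order: then `π/0 = 0` and the evaluation is at `1`. The case `m = 1` is separate because `sin θ`
vanishes. -/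
theorem U_eval_cos_pi_div_nonneg {m : ℕ} (k : ℕ) (hk : m = 0 ∨ k ≤ m) :
    0 ≤ (U ℝ ((k : ℤ) - 1)).eval (Real.cos (Real.pi / m)) := by
  rcases Nat.eq_zero_or_pos m with rfl | hm
  · simp
  rcases Nat.lt_or_ge m 2 with h2 | h2
  · obtain rfl : m = 1 := by omega
    have : k = 0 ∨ k = 1 := by omega
    rcases this with rfl | rfl <;> simp
  have hkm : (k : ℝ) ≤ m := by exact_mod_cast hk.resolve_left hm.ne'
  have hm0 : (0 : ℝ) < m := by exact_mod_cast hm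
  have hm2 : (2 : ℝ) ≤ m := by exact_mod_cast h2
  have hθ : (m : ℝ) * (Real.pi / m) = Real.pi := by field_simp
  have h := U_real_cos (Real.pi / m) ((k : ℤ) - 1)
  set θ := Real.pi / m
  have hθ0 : 0 < θ := by positivity
  have hs : 0 < Real.sin θ := Real.sin_pos_of_pos_of_lt_pi hθ0 (by nlinarith)
  have e : (((k : ℤ) - 1 : ℤ) + 1 : ℝ) * θ = k * θ := by push_cast; ring
  rw [e] at h
  have h0 : 0 ≤ Real.sin (k * θ) :=
    Real.sin_nonneg_of_nonneg_of_le_pi (by positivity) (by nlinarith)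
  rw [← h] at h0
  exact nonneg_of_mul_nonneg_left h0 hs

/-- Every element has a minimal coset representative for a standard rank two parabolic
subgroup; the remaining factor is written as an alternating word. -/
theorem exists_mul_alternatingWord {w : W} {i j : B} (hi : ¬ cs.IsRightDescent w i)
    (hj : cs.IsRightDescent w j) :
    ∃ (v : W) (k : ℕ), w = v * cs.wordProd (alternatingWord i j k) ∧
      cs.length w = cs.length v + k ∧ 1 ≤ k ∧ (M i j = 0 ∨ k + 1 ≤ M i j) ∧
      ¬ cs.IsRightDescent v i ∧ ¬ cs.IsRightDescent v j := by
  classical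
  let p : ℕ → Prop := fun k =>
    ∃ v, w = v * cs.wordProd (alternatingWord i j k) ∧ cs.length w = cs.length v + k
  have hp1 : p 1 := ⟨w * cs.simple j, by simp [alternatingWord], (cs.isRightDescent_iff.mp hj).symm⟩
  have hw1 : 1 ≤ cs.length w := by
    have := cs.isRightDescent_iff.mp hj
    omega
  -- Strip the longest possible alternating suffix. Maximality excludes one descent of `v`; the
  -- other would shorten `w` below its own length.
  set k := Nat.findGreatest p (cs.length w) with hk
  have hk1 : 1 ≤ k := Nat.le_findGreatest hw1 hp1
  obtain ⟨v, hv, hl⟩ : p k := Nat.findGreatest_spec hw1 hp1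
  have hmax : ∀ n, k < n → n ≤ cs.length w → ¬ p n := fun n h1 h2 =>
    Nat.findGreatest_is_greatest h1 h2
  have hc : ¬ cs.IsRightDescent v (if Even k then j else i) := by
    intro h
    have h1 := cs.isRightDescent_iff.mp h
    refine hmax (k + 1) (by omega) (by omega) ⟨v * cs.simple (if Even k then j else i), ?_, ?_⟩
    · rw [alternatingWord_succ', wordProd_cons, ← mul_assoc, simple_mul_simple_cancel_right]
      exact hv
    · omega
  have hd : ¬ cs.IsRightDescent v (if Even k then i else j) := by
    intro h
    have h1 := cs.isRightDescent_iff.mp h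
    obtain ⟨n, hn⟩ : ∃ n, k = n + 1 := ⟨k - 1, by omega⟩
    have hne : (if Even k then i else j) = (if Even n then j else i) := by
      by_cases hn' : Even n <;> simp [hn, hn', Nat.even_add_one]
    rw [hn, alternatingWord_succ', wordProd_cons, ← mul_assoc, ← hne] at hv
    have h2 := cs.length_mul_le (v * cs.simple (if Even k then i else j))
      (cs.wordProd (alternatingWord i j n))
    have h3 := cs.length_wordProd_le (alternatingWord i j n)
    rw [length_alternatingWord] at h3
    rw [← hv] at h2
    omega
  refine ⟨v, k, hv, hl, hk1, ?_, ?_, ?_⟩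
  · by_contra! hcon
    obtain ⟨hM, hM'⟩ := hcon
    have hle := cs.length_mul_le v (cs.wordProd (alternatingWord i j k))
    have hle' := cs.length_wordProd_le (alternatingWord i j k)
    rw [length_alternatingWord] at hle'
    rw [← hv] at hle
    have hred : cs.IsReduced (alternatingWord i j k) := by
      rw [IsReduced, length_alternatingWord]
      omega
    have hkM : k = M i j := by
      by_contra hne
      exact cs.not_isReduced_alternatingWord i j hM (by omega) hred
    obtain ⟨n, hn⟩ : ∃ n, k = n + 1 := ⟨k - 1, by omega⟩
    have hbraid := cs.wordProd_braidWord_eq i j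
    rw [braidWord, braidWord, M.symmetric j i, ← hkM] at hbraid
    -- For `k = M i j` the braid relation rewrites the suffix so that it ends in `i`, contradicting
    -- that `i` is not a descent of `w`.
    rw [hbraid, hn, alternatingWord_succ, wordProd_concat] at hv
    have hws : w * cs.simple i = v * cs.wordProd (alternatingWord i j n) := by
      rw [hv, ← mul_assoc, simple_mul_simple_cancel_right]
    have h2 := cs.length_mul_le v (cs.wordProd (alternatingWord i j n))
    have h3 := cs.length_wordProd_le (alternatingWord i j n)
    rw [length_alternatingWord] at h3
    rw [← hws] at h2
    apply hi
    rw [IsRightDescent]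
    omega
  · by_cases hke : Even k <;> simp only [hke, if_true, if_false] at hc hd <;> assumption
  · by_cases hke : Even k <;> simp only [hke, if_true, if_false] at hc hd <;> assumption

/-- Reduction to rank two: factor `w` as `v` times an alternating word. The word sends the simple
root to a combination of two simple roots whose coefficients are nonnegative Chebyshev values, and
the shorter `v` keeps both nonnegative by induction. -/
theorem geomRep_simpleRoot_nonneg {w : W} {i : B} (hi : ¬ cs.IsRightDescent w i) (a : B ⊕ B) :
    0 ≤ cs.geomRep w (M.simpleRoot i) a := by
  classical
  induction h : cs.length w using Nat.strong_induction_on generalizing w i with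
  | _ n ih =>
  by_cases hw : w = 1
  · subst hw
    simp only [map_one, LinearEquiv.coe_one, id, CoxeterMatrix.simpleRoot, Finsupp.single_apply]
    split_ifs <;> norm_num
  obtain ⟨j, hj⟩ := cs.exists_rightDescent_of_ne_one hw
  obtain ⟨v, k, hv, hl, hk, hm, hvi, hvj⟩ := cs.exists_mul_alternatingWord hi hj
  have h1 := ih _ (by omega) hvi rfl
  have h2 := ih _ (by omega) hvj rfl
  rw [hv, geomRep_mul_apply, geomRep_alternatingWord_apply]
  have hU := U_eval_cos_pi_div_nonneg (m := M i j) k (by omega)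
  have hU' := U_eval_cos_pi_div_nonneg (m := M i j) (k + 1) (by omega)
  rw [show (((k + 1 : ℕ) : ℤ) - 1) = k by simp] at hU'
  simp only [map_add, map_smul, Finsupp.add_apply, Finsupp.smul_apply, smul_eq_mul]
  split_ifs <;> positivity

end CoxeterSystem

/-! ### Roots and reflections -/

namespace CoxeterSystem

variable {B W : Type*} [Group W] {M : CoxeterMatrix B} (cs : CoxeterSystem M W)

/-- The roots: the images of the simple roots under the group. -/
def IsRoot (d : M.RootSpace) : Prop := ∃ w i, d = cs.geomRep w (M.simpleRoot i)

/-- The sum of the coefficients. -/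
noncomputable def _root_.CoxeterMatrix.height (M : CoxeterMatrix B) : M.RootSpace →ₗ[ℝ] ℝ :=
  Finsupp.linearCombination ℝ fun _ => 1

theorem _root_.CoxeterMatrix.height_simpleRoot (M : CoxeterMatrix B) (i : B) :
    M.height (M.simpleRoot i) = 1 := by
  simp [CoxeterMatrix.height, CoxeterMatrix.simpleRoot]

theorem isRoot_simpleRoot (i : B) : cs.IsRoot (M.simpleRoot i) := ⟨1, i, by simp⟩

variable {cs}

namespace IsRoot

variable {d d' : M.RootSpace}

theorem form_self (hd : cs.IsRoot d) : M.form d d = 1 := by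
  obtain ⟨w, i, rfl⟩ := hd
  rw [form_geomRep, M.form_simpleRoot_self]

theorem ne_zero (hd : cs.IsRoot d) : d ≠ 0 := by
  rintro rfl
  simpa using hd.form_self

theorem geomRep (hd : cs.IsRoot d) (w : W) : cs.IsRoot (cs.geomRep w d) := by
  obtain ⟨v, i, rfl⟩ := hd
  exact ⟨w * v, i, by rw [geomRep_mul_apply]⟩

theorem neg (hd : cs.IsRoot d) : cs.IsRoot (-d) := by
  obtain ⟨v, i, rfl⟩ := hd
  exact ⟨v * cs.simple i, i, by rw [geomRep_mul_apply, geomRep_simple_simpleRoot, map_neg]⟩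

theorem nonneg_or_nonpos (hd : cs.IsRoot d) : (∀ a, 0 ≤ d a) ∨ ∀ a, d a ≤ 0 := by
  obtain ⟨w, i, rfl⟩ := hd
  by_cases h : cs.IsRightDescent w i
  · right
    intro a
    have := cs.geomRep_simpleRoot_nonneg (cs.isRightDescent_iff_not_isRightDescent_mul.mp h) a
    rw [geomRep_mul_apply, geomRep_simple_simpleRoot, map_neg, Finsupp.neg_apply] at this
    linarith
  · exact Or.inl fun a => cs.geomRep_simpleRoot_nonneg h a

theorem apply_inr (hd : cs.IsRoot d) (i : B) : d (.inr i) = 0 := by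
  obtain ⟨w, j, rfl⟩ := hd
  rw [geomRep_apply_inr]
  simp [CoxeterMatrix.simpleRoot]

end IsRoot

theorem _root_.CoxeterMatrix.height_pos_of_nonneg {d : M.RootSpace} (h0 : d ≠ 0)
    (h : ∀ a, 0 ≤ d a) : 0 < M.height d := by
  obtain ⟨a, ha⟩ := Finsupp.ne_iff.mp h0
  simp only [CoxeterMatrix.height, Finsupp.linearCombination_apply, smul_eq_mul, mul_one]
  exact Finset.sum_pos' (fun i _ => h i)
    ⟨a, Finsupp.mem_support_iff.mpr ha, lt_of_le_of_ne (h a) (Ne.symm ha)⟩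

namespace IsRoot

variable {d d' : M.RootSpace}

theorem height_ne_zero (hd : cs.IsRoot d) : M.height d ≠ 0 := by
  rcases hd.nonneg_or_nonpos with h | h
  · exact (M.height_pos_of_nonneg hd.ne_zero h).ne'
  · have := M.height_pos_of_nonneg (neg_ne_zero.mpr hd.ne_zero) (fun a => by simpa using h a)
    rw [map_neg] at this
    linarith

theorem height_pos_iff (hd : cs.IsRoot d) : 0 < M.height d ↔ ∀ a, 0 ≤ d a := by
  refine ⟨fun h => ?_, M.height_pos_of_nonneg hd.ne_zero⟩
  rcases hd.nonneg_or_nonpos with h' | h'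
  · exact h'
  · have := M.height_pos_of_nonneg (neg_ne_zero.mpr hd.ne_zero) (fun a => by simpa using h' a)
    rw [map_neg] at this
    linarith

theorem eq_or_eq_neg_of_smul (hd : cs.IsRoot d) (hd' : M.form d' d' = 1) {c : ℝ}
    (h : d' = c • d) : d' = d ∨ d' = -d := by
  have h1 : c * c = 1 := by
    rw [h] at hd'
    simpa [hd.form_self] using hd'
  rcases mul_self_eq_one_iff.mp h1 with rfl | rfl
  · left; simpa using h
  · right; simpa using h

/-- Proportional positive roots are equal. -/
theorem eq_of_smul (hd : cs.IsRoot d) (hd' : cs.IsRoot d') (hp : 0 < M.height d)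
    (hp' : 0 < M.height d') {c : ℝ} (h : d' = c • d) : d' = d := by
  refine (hd.eq_or_eq_neg_of_smul hd'.form_self h).resolve_right ?_
  rintro rfl
  rw [map_neg] at hp'
  linarith

/-- A simple reflection permutes the positive roots other than its own. -/
theorem height_simple_pos (hd : cs.IsRoot d) (hp : 0 < M.height d) {i : B}
    (hi : d ≠ M.simpleRoot i) : 0 < M.height (cs.geomRep (cs.simple i) d) := by
  have hn := hd.height_pos_iff.mp hp
  obtain ⟨a, ha, ha'⟩ : ∃ a, a ≠ .inl i ∧ d a ≠ 0 := by
    by_contra! hcon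
    apply hi
    refine (cs.isRoot_simpleRoot i).eq_of_smul hd (by rw [M.height_simpleRoot]; norm_num) hp
      (c := d (.inl i)) ?_
    ext a
    by_cases h : a = .inl i
    · subst h; simp [CoxeterMatrix.simpleRoot]
    · simp [CoxeterMatrix.simpleRoot, hcon a h, Ne.symm h]
  have hs : cs.geomRep (cs.simple i) d a = d a := by
    rw [geomRep_simple_apply]
    simp [CoxeterMatrix.simpleRoot, ha.symm]
  have hsd := hd.geomRep (cs.simple i)
  rcases hsd.nonneg_or_nonpos with h | h
  · exact hsd.height_pos_iff.mpr h
  · have := h a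
    rw [hs] at this
    exact absurd (le_antisymm this (hn a)) ha'

end IsRoot

variable (cs)

theorem height_geomRep_simpleRoot_pos_iff (w : W) (i : B) :
    0 < M.height (cs.geomRep w (M.simpleRoot i)) ↔ ¬ cs.IsRightDescent w i := by
  have hr := (cs.isRoot_simpleRoot i).geomRep w
  constructor
  · intro h h'
    have hr' := (cs.isRoot_simpleRoot i).geomRep (w * cs.simple i)
    have := hr'.height_pos_iff.mpr
      (cs.geomRep_simpleRoot_nonneg (cs.isRightDescent_iff_not_isRightDescent_mul.mp h'))
    rw [geomRep_mul_apply, geomRep_simple_simpleRoot, map_neg, map_neg] at this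
    linarith
  · exact fun h => hr.height_pos_iff.mpr (cs.geomRep_simpleRoot_nonneg h)

/-- A nontrivial element has a right descent, hence makes some simple root negative. -/
theorem geomRep_injective : Function.Injective cs.geomRep := by
  rw [injective_iff_map_eq_one]
  intro w hw
  by_contra h
  obtain ⟨i, hi⟩ := cs.exists_rightDescent_of_ne_one h
  refine (cs.height_geomRep_simpleRoot_pos_iff w i).mp ?_ hi
  rw [hw, LinearEquiv.coe_one, id, M.height_simpleRoot]
  norm_num

theorem ext_geomRep {w w' : W} (h : ∀ v, cs.geomRep w v = cs.geomRep w' v) : w = w' :=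
  cs.geomRep_injective (LinearEquiv.ext h)

open Classical in
/-- The reflection in a root. -/
noncomputable def rootReflection (d : M.RootSpace) : W :=
  if h : cs.IsRoot d then h.choose * cs.simple h.choose_spec.choose * h.choose⁻¹ else 1

theorem geomRep_conj_apply {t w : W} {d : M.RootSpace}
    (h : ∀ v, cs.geomRep t v = v - (2 * M.form d v) • d) (v : M.RootSpace) :
    cs.geomRep (w * t * w⁻¹) v =
      v - (2 * M.form (cs.geomRep w d) v) • cs.geomRep w d := by
  have e : cs.geomRep w (cs.geomRep w⁻¹ v) = v := by
    rw [← geomRep_mul_apply]; simp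
  rw [geomRep_mul_apply, geomRep_mul_apply, h, map_sub, map_smul, e]
  congr 3
  conv_rhs => rw [← e, form_geomRep]

namespace IsRoot

variable {cs} {d d' : M.RootSpace}

theorem rootReflection_apply (hd : cs.IsRoot d) (v : M.RootSpace) :
    cs.geomRep (cs.rootReflection d) v = v - (2 * M.form d v) • d := by
  have h : cs.rootReflection d =
      hd.choose * cs.simple hd.choose_spec.choose * hd.choose⁻¹ := by
    rw [rootReflection, dif_pos hd]
  have h' := hd.choose_spec.choose_spec
  rw [h, cs.geomRep_conj_apply (cs.geomRep_simple_apply _) v, ← h']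

theorem isReflection (hd : cs.IsRoot d) : cs.IsReflection (cs.rootReflection d) := by
  rw [rootReflection, dif_pos hd]
  exact ⟨_, _, rfl⟩

theorem rootReflection_self (hd : cs.IsRoot d) :
    cs.geomRep (cs.rootReflection d) d = -d := by
  rw [hd.rootReflection_apply, hd.form_self]
  module

theorem mul_self (hd : cs.IsRoot d) : cs.rootReflection d * cs.rootReflection d = 1 :=
  hd.isReflection.mul_self

theorem rootReflection_neg (hd : cs.IsRoot d) :
    cs.rootReflection (-d) = cs.rootReflection d := by
  apply cs.ext_geomRep
  intro v
  rw [hd.rootReflection_apply, hd.neg.rootReflection_apply]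
  simp

theorem rootReflection_geomRep (hd : cs.IsRoot d) (w : W) :
    cs.rootReflection (cs.geomRep w d) = w * cs.rootReflection d * w⁻¹ := by
  apply cs.ext_geomRep
  intro v
  rw [(hd.geomRep w).rootReflection_apply, cs.geomRep_conj_apply hd.rootReflection_apply]

theorem eq_rootReflection (hd : cs.IsRoot d) {t : W}
    (h : ∀ v, cs.geomRep t v = v - (2 * M.form d v) • d) : t = cs.rootReflection d := by
  apply cs.ext_geomRep
  intro v
  rw [h, hd.rootReflection_apply]

theorem eq_or_eq_neg_of_rootReflection_eq (hd : cs.IsRoot d) (hd' : cs.IsRoot d')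
    (h : cs.rootReflection d = cs.rootReflection d') : d' = d ∨ d' = -d := by
  have h1 := hd'.rootReflection_self
  rw [← h, hd.rootReflection_apply] at h1
  refine hd.eq_or_eq_neg_of_smul hd'.form_self (c := M.form d d') ?_
  have : (2 : ℝ) • d' = (2 : ℝ) • (M.form d d' • d) := by
    rw [smul_smul, ← sub_eq_zero]
    rw [← sub_eq_zero] at h1
    rw [← h1]
    module
  exact smul_right_injective _ (two_ne_zero) this

theorem eq_of_rootReflection_eq (hd : cs.IsRoot d) (hd' : cs.IsRoot d') (hp : 0 < M.height d)
    (hp' : 0 < M.height d') (h : cs.rootReflection d = cs.rootReflection d') : d' = d := by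
  refine (hd.eq_or_eq_neg_of_rootReflection_eq hd' h).resolve_right ?_
  rintro rfl
  rw [map_neg] at hp'
  linarith

end IsRoot

theorem rootReflection_simpleRoot (i : B) :
    cs.rootReflection (M.simpleRoot i) = cs.simple i :=
  ((cs.isRoot_simpleRoot i).eq_rootReflection (cs.geomRep_simple_apply i)).symm

variable {cs} in
theorem IsReflection.exists_root {t : W} (ht : cs.IsReflection t) :
    ∃ d, cs.IsRoot d ∧ 0 < M.height d ∧ t = cs.rootReflection d := by
  obtain ⟨w, i, rfl⟩ := ht
  have hr := (cs.isRoot_simpleRoot i).geomRep w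
  have he : w * cs.simple i * w⁻¹ = cs.rootReflection (cs.geomRep w (M.simpleRoot i)) := by
    rw [(cs.isRoot_simpleRoot i).rootReflection_geomRep, rootReflection_simpleRoot]
  rcases lt_or_gt_of_ne hr.height_ne_zero with h | h
  · exact ⟨_, hr.neg, by rw [map_neg]; linarith, by rw [hr.rootReflection_neg, he]⟩
  · exact ⟨_, hr, h, he⟩

/-- A group element acting as the orthogonal reflection in a vector of norm `1` is a reflection
in a root. -/
theorem isRoot_of_geomRep_apply {g : W} {d : M.RootSpace} (hd : M.form d d = 1)
    (hg : ∀ v, cs.geomRep g v = v - (2 * M.form d v) • d) : cs.IsRoot d := by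
  induction h : cs.length g using Nat.strong_induction_on generalizing g d with
  | _ n ih =>
  have hg1 : g ≠ 1 := by
    rintro rfl
    have h1 := hg d
    rw [map_one, LinearEquiv.coe_one, id, hd] at h1
    have h2 : (2 : ℝ) • d = d - (d - (2 * 1 : ℝ) • d) := by module
    rw [← h1, sub_self] at h2
    simp [(smul_eq_zero_iff_right (two_ne_zero' ℝ)).mp h2] at hd
  have hgg : g * g = 1 := by
    apply cs.ext_geomRep
    intro v
    rw [geomRep_mul_apply, hg, hg]
    simp only [map_sub, map_smul, smul_eq_mul, hd, map_one, LinearEquiv.coe_one, id]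
    module
  obtain ⟨i, hi⟩ := cs.exists_rightDescent_of_ne_one hg1
  have hconj : ∀ v, cs.geomRep (cs.simple i * g * (cs.simple i)⁻¹) v =
      v - (2 * M.form (cs.geomRep (cs.simple i) d) v) • cs.geomRep (cs.simple i) d :=
    cs.geomRep_conj_apply hg
  rw [inv_simple] at hconj
  by_cases hlt : cs.length (cs.simple i * g * cs.simple i) < n
  · have := (ih _ hlt (by rw [form_geomRep, hd]) hconj rfl).geomRep (cs.simple i)
    rwa [← geomRep_mul_apply, simple_mul_simple_self, map_one, LinearEquiv.coe_one, id] at this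
  -- Conjugation does not shorten `g`, so `i` is not a right descent of `s g`. Thus `-g α` is
  -- positive and becomes negative under `s`, which forces `-g α = α`; then `α` is proportional to
  -- `d`.
  · have hsg : cs.length (cs.simple i * g) = cs.length (g * cs.simple i) := by
      rw [← cs.length_inv, mul_inv_rev, inv_simple, inv_eq_of_mul_eq_one_left hgg]
    have hi' := cs.isRightDescent_iff.mp hi
    have hnd : ¬ cs.IsRightDescent (cs.simple i * g) i := by
      rw [IsRightDescent]
      omega
    have h1 := (cs.height_geomRep_simpleRoot_pos_iff _ i).mpr hnd
    have h2 : ¬ 0 < M.height (cs.geomRep g (M.simpleRoot i)) := fun h' =>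
      (cs.height_geomRep_simpleRoot_pos_iff g i).mp h' hi
    have hr := (cs.isRoot_simpleRoot i).geomRep g
    have h3 : 0 < M.height (-(cs.geomRep g (M.simpleRoot i))) := by
      rw [map_neg]
      have := hr.height_ne_zero
      rcases lt_or_gt_of_ne this with h | h
      · linarith
      · exact absurd h h2
    have h4 : -(cs.geomRep g (M.simpleRoot i)) = M.simpleRoot i := by
      by_contra hne
      have := hr.neg.height_simple_pos h3 hne
      rw [map_neg, map_neg, ← geomRep_mul_apply] at this
      linarith
    rw [hg] at h4
    set c := M.form d (M.simpleRoot i)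
    have h5 : M.simpleRoot i = c • d := by
      have : (2 : ℝ) • M.simpleRoot i = (2 : ℝ) • (c • d) := by
        nth_rewrite 1 [two_smul]
        nth_rewrite 1 [← h4]
        module
      exact smul_right_injective _ (two_ne_zero) this
    have hc : c * c = 1 := by
      have := M.form_simpleRoot_self i
      rw [h5] at this
      simpa [hd] using this
    have h6 : d = c • M.simpleRoot i := by
      rw [h5, smul_smul, hc, one_smul]
    rcases (cs.isRoot_simpleRoot i).eq_or_eq_neg_of_smul hd h6 with h | h
    · rw [h]; exact cs.isRoot_simpleRoot i
    · rw [h]; exact (cs.isRoot_simpleRoot i).neg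

variable {cs} in
/-- The coroots of two non-proportional roots are independent. -/
theorem IsRoot.exists_form_eq_zero {d d' : M.RootSpace} (hd : cs.IsRoot d) (hd' : cs.IsRoot d')
    (h : ∀ c : ℝ, d ≠ c • d') : ∃ v, M.form d' v = 0 ∧ M.form d v ≠ 0 := by
  obtain ⟨i, hi⟩ : ∃ i, d' (.inl i) ≠ 0 := by
    by_contra! hcon
    apply hd'.ne_zero
    ext (a | a)
    · simpa using hcon a
    · simpa using hd'.apply_inr a
  obtain ⟨j, hj⟩ : ∃ j, d (.inl j) ≠ d (.inl i) / d' (.inl i) * d' (.inl j) := by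
    by_contra! hcon
    apply h (d (.inl i) / d' (.inl i))
    ext (a | a)
    · simpa using hcon a
    · simp [hd.apply_inr a, hd'.apply_inr a]
  refine ⟨d' (.inl i) • Finsupp.single (.inr j) 1 - d' (.inl j) • Finsupp.single (.inr i) 1, ?_, ?_⟩
  · rw [map_sub, map_smul, map_smul, M.form_symm d', M.form_symm d', M.form_single_inr,
      M.form_single_inr, smul_eq_mul, smul_eq_mul]
    ring
  · rw [map_sub, map_smul, map_smul, M.form_symm d, M.form_symm d, M.form_single_inr,
      M.form_single_inr, smul_eq_mul, smul_eq_mul]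
    intro h0
    apply hj
    field_simp
    linarith

end CoxeterSystem

/-! ### Inversions relative to a reflection-closed set of roots -/

namespace CoxeterSystem

variable {B W : Type*} [Group W] {M : CoxeterMatrix B} (cs : CoxeterSystem M W)

/-- A set of roots closed under negation and under the reflections in its elements. -/
structure IsReflectionClosed (Ψ : Set M.RootSpace) : Prop where
  isRoot : ∀ d ∈ Ψ, cs.IsRoot d
  neg : ∀ d ∈ Ψ, -d ∈ Ψ
  refl : ∀ d ∈ Ψ, ∀ d' ∈ Ψ, cs.geomRep (cs.rootReflection d) d' ∈ Ψ

theorem isReflectionClosed_isRoot : cs.IsReflectionClosed {d | cs.IsRoot d} :=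
  ⟨fun _ h => h, fun _ h => h.neg, fun _ _ _ h' => h'.geomRep _⟩

/-- The positive roots in `Ψ` made negative by `z`. -/
def inversions (Ψ : Set M.RootSpace) (z : W) : Set M.RootSpace :=
  {d | d ∈ Ψ ∧ 0 < M.height d ∧ M.height (cs.geomRep z d) < 0}

/-- The number of positive roots in `Ψ` made negative by `z`. -/
noncomputable def relLength (Ψ : Set M.RootSpace) (z : W) : ℕ := (cs.inversions Ψ z).ncard

/-- The inversions of `z t` that do not come from inversions of `z`, for the reflection `t` in
the root `r`. -/
def newInversions (Ψ : Set M.RootSpace) (z : W)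
    (r : M.RootSpace) : Set M.RootSpace :=
  {d | d ∈ Ψ ∧ 0 < M.height d ∧ M.height (cs.geomRep (cs.rootReflection r) d) < 0 ∧
    0 < M.height (cs.geomRep z d) ∧
    M.height (cs.geomRep z (cs.geomRep (cs.rootReflection r) d)) < 0}

/-- Right multiplication by a simple reflection transports inversions and adds at most its own
simple root. -/
theorem finite_inversions_isRoot (z : W) : (cs.inversions {d | cs.IsRoot d} z).Finite := by
  induction z using cs.simple_induction_right with
  | one =>
    refine Set.Finite.subset Set.finite_empty ?_
    rintro d ⟨_, h1, h2⟩
    rw [map_one, LinearEquiv.coe_one, id] at h2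
    exact absurd h1 h2.not_gt
  | mul_simple_right w i ih =>
    refine ((ih.image (cs.geomRep (cs.simple i))).insert (M.simpleRoot i)).subset ?_
    rintro d ⟨h, h1, h2⟩
    by_cases hd : d = M.simpleRoot i
    · exact Or.inl hd
    · refine Or.inr ⟨cs.geomRep (cs.simple i) d, ⟨IsRoot.geomRep h _, ?_, ?_⟩, ?_⟩
      · exact IsRoot.height_simple_pos h h1 hd
      · rwa [← geomRep_mul_apply]
      · rw [← geomRep_mul_apply, simple_mul_simple_self, map_one, LinearEquiv.coe_one, id]

variable {cs} {Ψ : Set M.RootSpace}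

namespace IsReflectionClosed

theorem finite_inversions (hΨ : cs.IsReflectionClosed Ψ) (z : W) :
    (cs.inversions Ψ z).Finite :=
  (cs.finite_inversions_isRoot z).subset fun d hd => ⟨hΨ.isRoot d hd.1, hd.2⟩

theorem newInversions_subset (z : W) (r : M.RootSpace) :
    cs.newInversions Ψ z r ⊆ cs.inversions Ψ (z * cs.rootReflection r) :=
  fun d hd => ⟨hd.1, hd.2.1, by rw [geomRep_mul_apply]; exact hd.2.2.2.2⟩

theorem rootReflection_rootReflection {r : M.RootSpace} (hr : cs.IsRoot r) (d : M.RootSpace) :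
    cs.geomRep (cs.rootReflection r) (cs.geomRep (cs.rootReflection r) d) = d := by
  rw [← geomRep_mul_apply, hr.mul_self, map_one, LinearEquiv.coe_one, id]

/-- If `r` is made positive by `z` and `d` is a positive root made negative both by `z` and by the
reflection in `r`, then `z t` makes `d` negative. -/
theorem height_neg_of_neg {z : W} {r d : M.RootSpace} (hr : cs.IsRoot r) (hr0 : 0 < M.height r)
    (hz : 0 < M.height (cs.geomRep z r)) (hd0 : 0 < M.height d)
    (h1 : M.height (cs.geomRep (cs.rootReflection r) d) < 0)
    (h2 : M.height (cs.geomRep z d) < 0) :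
    M.height (cs.geomRep z (cs.geomRep (cs.rootReflection r) d)) < 0 := by
  rw [hr.rootReflection_apply] at h1 ⊢
  simp only [map_sub, map_smul, smul_eq_mul] at h1 ⊢
  -- The reflection subtracts `2 (r,d) r` from `d`; only a positive coefficient can make the
  -- positive root `d` negative.
  have hf : 0 < M.form r d := by
    by_contra hf
    nlinarith
  nlinarith [mul_pos hf hz]

/-- An inversion `d` of `z` is sent to `t d` when that is positive and kept otherwise. This injects
the inversions of `z` into those of `z t`, missing exactly the new ones. -/
theorem relLength_mul_rootReflection (hΨ : cs.IsReflectionClosed Ψ) {z : W} {r : M.RootSpace}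
    (hr : r ∈ Ψ) (hr0 : 0 < M.height r) (hz : 0 < M.height (cs.geomRep z r)) :
    cs.relLength Ψ (z * cs.rootReflection r) =
      cs.relLength Ψ z + (cs.newInversions Ψ z r).ncard := by
  classical
  have hrr := hΨ.isRoot r hr
  have hinv := rootReflection_rootReflection hrr
  set t := cs.rootReflection r with ht
  let φ : M.RootSpace → M.RootSpace := fun d =>
    if 0 < M.height (cs.geomRep t d) then cs.geomRep t d else d
  have hbij : Set.BijOn φ (cs.inversions Ψ z)
      (cs.inversions Ψ (z * t) \ cs.newInversions Ψ z r) := by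
    refine ⟨?_, ?_, ?_⟩
    · rintro d ⟨hd, hd0, hdz⟩
      by_cases h : 0 < M.height (cs.geomRep t d)
      · simp only [φ, h, if_true]
        refine ⟨⟨hΨ.refl r hr d hd, h, ?_⟩, ?_⟩
        · rwa [geomRep_mul_apply, hinv]
        · rintro ⟨_, _, h', _⟩
          rw [← ht, hinv] at h'
          exact absurd hd0 h'.not_gt
      · simp only [φ, h, if_false]
        have h' : M.height (cs.geomRep t d) < 0 :=
          lt_of_le_of_ne (not_lt.mp h) ((hΨ.isRoot d hd).geomRep t).height_ne_zero
        refine ⟨⟨hd, hd0, ?_⟩, ?_⟩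
        · rw [geomRep_mul_apply]
          exact height_neg_of_neg hrr hr0 hz hd0 h' hdz
        · rintro ⟨_, _, _, h'', _⟩
          exact absurd hdz h''.not_gt
    · rintro d ⟨hd, hd0, hdz⟩ d' ⟨hd', hd0', hdz'⟩ he
      simp only [φ] at he
      split_ifs at he with h h' h'
      · exact (cs.geomRep t).injective he
      · rw [← he, hinv] at h'
        exact absurd hd0 h'
      · rw [he, hinv] at h
        exact absurd hd0' h
      · exact he
    · rintro d ⟨⟨hd, hd0, hdz⟩, hn⟩
      rw [geomRep_mul_apply] at hdz
      by_cases h : 0 < M.height (cs.geomRep t d)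
      · refine ⟨cs.geomRep t d, ⟨hΨ.refl r hr d hd, h, hdz⟩, ?_⟩
        simp only [φ, hinv, hd0, if_true]
      · have h' : M.height (cs.geomRep t d) < 0 :=
          lt_of_le_of_ne (not_lt.mp h) ((hΨ.isRoot d hd).geomRep t).height_ne_zero
        refine ⟨d, ⟨hd, hd0, ?_⟩, by simp only [φ, h, if_false]⟩
        by_contra h0
        exact hn ⟨hd, hd0, h', lt_of_le_of_ne (not_lt.mp h0)
          ((hΨ.isRoot d hd).geomRep z).height_ne_zero.symm, hdz⟩
  have hfin := hΨ.finite_inversions (z * t)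
  have h1 : (cs.inversions Ψ z).ncard =
      (cs.inversions Ψ (z * t) \ cs.newInversions Ψ z r).ncard := by
    rw [← hbij.image_eq, hbij.injOn.ncard_image]
  rw [relLength, relLength, h1,
    Set.ncard_sdiff_add_ncard_of_subset (newInversions_subset z r) hfin]

theorem self_mem_newInversions (hΨ : cs.IsReflectionClosed Ψ) {z : W} {r : M.RootSpace}
    (hr : r ∈ Ψ) (hr0 : 0 < M.height r) (hz : 0 < M.height (cs.geomRep z r)) :
    r ∈ cs.newInversions Ψ z r := by
  refine ⟨hr, hr0, ?_, hz, ?_⟩ <;> rw [(hΨ.isRoot r hr).rootReflection_self] <;>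
    simp only [map_neg] <;> linarith

theorem finite_newInversions (hΨ : cs.IsReflectionClosed Ψ) (z : W) (r : M.RootSpace) :
    (cs.newInversions Ψ z r).Finite :=
  (hΨ.finite_inversions _).subset (newInversions_subset z r)

theorem relLength_lt_mul (hΨ : cs.IsReflectionClosed Ψ) {z : W} {r : M.RootSpace}
    (hr : r ∈ Ψ) (hr0 : 0 < M.height r) (hz : 0 < M.height (cs.geomRep z r)) :
    cs.relLength Ψ z < cs.relLength Ψ (z * cs.rootReflection r) := by
  rw [hΨ.relLength_mul_rootReflection hr hr0 hz]
  have := (Set.ncard_pos (hΨ.finite_newInversions z r)).mpr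
    ⟨r, hΨ.self_mem_newInversions hr hr0 hz⟩
  omega

theorem relLength_mul_lt (hΨ : cs.IsReflectionClosed Ψ) {z : W} {r : M.RootSpace}
    (hr : r ∈ Ψ) (hr0 : 0 < M.height r) (hz : M.height (cs.geomRep z r) < 0) :
    cs.relLength Ψ (z * cs.rootReflection r) < cs.relLength Ψ z := by
  have hrr := hΨ.isRoot r hr
  have := hΨ.relLength_lt_mul (z := z * cs.rootReflection r) hr hr0 (by
    rw [geomRep_mul_apply, hrr.rootReflection_self, map_neg, map_neg]
    linarith)
  rwa [mul_assoc, hrr.mul_self, mul_one] at this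

theorem relLength_lt_mul_iff (hΨ : cs.IsReflectionClosed Ψ) {z : W} {r : M.RootSpace}
    (hr : r ∈ Ψ) (hr0 : 0 < M.height r) :
    cs.relLength Ψ z < cs.relLength Ψ (z * cs.rootReflection r) ↔
      0 < M.height (cs.geomRep z r) := by
  refine ⟨fun h => ?_, hΨ.relLength_lt_mul hr hr0⟩
  by_contra h0
  exact absurd h (hΨ.relLength_mul_lt hr hr0 (lt_of_le_of_ne (not_lt.mp h0)
    ((hΨ.isRoot r hr).geomRep z).height_ne_zero)).not_gt

/-- If `e` is the only positive root of `Ψ` made negative by its reflection, then this reflection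
changes the relative length by one. -/
theorem relLength_mul_simple (hΨ : cs.IsReflectionClosed Ψ) {z : W} {e : M.RootSpace}
    (he : e ∈ Ψ) (he0 : 0 < M.height e)
    (hs : ∀ d ∈ Ψ, 0 < M.height d → M.height (cs.geomRep (cs.rootReflection e) d) < 0 → d = e)
    (hz : 0 < M.height (cs.geomRep z e)) :
    cs.relLength Ψ (z * cs.rootReflection e) = cs.relLength Ψ z + 1 := by
  rw [hΨ.relLength_mul_rootReflection he he0 hz]
  have : cs.newInversions Ψ z e = {e} :=
    Set.eq_singleton_iff_unique_mem.mpr ⟨hΨ.self_mem_newInversions he he0 hz,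
      fun d hd => hs d hd.1 hd.2.1 hd.2.2.1⟩
  rw [this, Set.ncard_singleton]

/-- New inversions other than `r` come in pairs. -/
theorem add_three_le_relLength_mul (hΨ : cs.IsReflectionClosed Ψ) {z : W} {r d : M.RootSpace}
    (hr : r ∈ Ψ) (hr0 : 0 < M.height r) (hz : 0 < M.height (cs.geomRep z r))
    (hd : d ∈ cs.newInversions Ψ z r) (hdr : d ≠ r) :
    cs.relLength Ψ z + 3 ≤ cs.relLength Ψ (z * cs.rootReflection r) := by
  classical
  rw [hΨ.relLength_mul_rootReflection hr hr0 hz]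
  have hrr := hΨ.isRoot r hr
  have hinv := rootReflection_rootReflection hrr
  -- The map `d ↦ -t d` is an involution on new inversions, and a fixed point would be proportional
  -- to `r`. So `r`, `d` and `d'` are three distinct new inversions.
  set d' := -cs.geomRep (cs.rootReflection r) d with hd'
  have hmem : d' ∈ cs.newInversions Ψ z r := by
    obtain ⟨h1, h2, h3, h4, h5⟩ := hd
    refine ⟨hΨ.neg _ (hΨ.refl r hr d h1), ?_, ?_, ?_, ?_⟩ <;>
      simp only [hd', map_neg, hinv] <;> linarith
  have hprop : ∀ c : ℝ, d ≠ c • r := fun c hc =>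
    hdr (hrr.eq_of_smul (hΨ.isRoot d hd.1) hr0 hd.2.1 hc)
  have h1 : d' ≠ r := by
    intro h
    apply hdr
    have := congrArg (cs.geomRep (cs.rootReflection r)) h
    rw [hd', map_neg, hinv, hrr.rootReflection_self] at this
    exact neg_injective this
  have h2 : d' ≠ d := by
    intro h
    apply hprop (M.form r d)
    rw [hd', hrr.rootReflection_apply] at h
    have : (2 : ℝ) • d = (2 : ℝ) • (M.form r d • r) := by
      nth_rewrite 1 [two_smul]
      nth_rewrite 1 [← h]
      module
    exact smul_right_injective _ (two_ne_zero) this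
  have hsub : ({r, d, d'} : Set M.RootSpace) ⊆ cs.newInversions Ψ z r := by
    rintro a (rfl | rfl | rfl)
    · exact hΨ.self_mem_newInversions hr hr0 hz
    · exact hd
    · exact hmem
  have hcard : ({r, d, d'} : Set M.RootSpace).ncard = 3 := by
    rw [Set.ncard_eq_three]
    exact ⟨r, d, d', hdr.symm, h1.symm, h2.symm, rfl⟩
  have := Set.ncard_le_ncard hsub (hΨ.finite_newInversions z r)
  omega

end IsReflectionClosed

variable (cs)

/-- Strip right descents one at a time: a simple reflection makes only its own positive root
negative, so both counts drop by one. -/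
theorem relLength_isRoot (w : W) : cs.relLength {d | cs.IsRoot d} w = cs.length w := by
  induction h : cs.length w generalizing w with
  | zero =>
    obtain rfl := cs.length_eq_zero_iff.mp h
    rw [relLength, Set.ncard_eq_zero (cs.finite_inversions_isRoot 1), Set.eq_empty_iff_forall_notMem]
    rintro d ⟨_, h1, h2⟩
    rw [map_one, LinearEquiv.coe_one, id] at h2
    exact absurd h1 h2.not_gt
  | succ n ih =>
    have hw : w ≠ 1 := by
      rintro rfl
      simp at h
    obtain ⟨i, hi⟩ := cs.exists_rightDescent_of_ne_one hw
    have hi' := cs.isRightDescent_iff.mp hi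
    have := ih (w * cs.simple i) (by omega)
    have key := cs.isReflectionClosed_isRoot.relLength_mul_simple (z := w * cs.simple i)
      (cs.isRoot_simpleRoot i) (by rw [M.height_simpleRoot]; norm_num) (by
        intro d hd hd0 hneg
        by_contra hne
        rw [rootReflection_simpleRoot] at hneg
        exact absurd (IsRoot.height_simple_pos hd hd0 hne) hneg.not_gt)
      ((cs.height_geomRep_simpleRoot_pos_iff _ i).mpr
        (cs.isRightDescent_iff_not_isRightDescent_mul.mp hi))
    rw [rootReflection_simpleRoot, simple_mul_simple_cancel_right, this] at key
    exact key

theorem length_lt_mul_rootReflection_iff {w : W} {r : M.RootSpace} (hr : cs.IsRoot r)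
    (hr0 : 0 < M.height r) :
    cs.length w < cs.length (w * cs.rootReflection r) ↔ 0 < M.height (cs.geomRep w r) := by
  rw [← relLength_isRoot, ← relLength_isRoot]
  exact cs.isReflectionClosed_isRoot.relLength_lt_mul_iff hr hr0

end CoxeterSystem

/-! ### Planes of roots -/

/-- An area form on a plane. -/
structure PlaneForm {E : Type*} [AddCommGroup E] [Module ℝ E] (P : Submodule ℝ E) where
  /-- the underlying bilinear form -/
  form : E →ₗ[ℝ] E →ₗ[ℝ] ℝ
  alt : ∀ x, form x x = 0
  cyclic : ∀ x ∈ P, ∀ y ∈ P, ∀ z ∈ P, form x y • z + form y z • x + form z x • y = 0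
  nondeg : ∃ x ∈ P, ∃ y ∈ P, form x y ≠ 0

namespace PlaneForm

variable {E : Type*} [AddCommGroup E] [Module ℝ E] {P : Submodule ℝ E} (ω : PlaneForm P)

theorem skew (x y : E) : ω.form x y = -ω.form y x := by
  have h := ω.alt (x + y)
  simp only [map_add, LinearMap.add_apply, ω.alt] at h
  linarith

/-- Nondegeneracy gives some `z` in the plane with `ω z x ≠ 0`; the cyclic identity for `x, y, z`
can then be solved for `y`. -/
theorem exists_smul {x y : E} (hx : x ∈ P) (hy : y ∈ P) (hx0 : x ≠ 0) (h : ω.form x y = 0) :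
    ∃ c : ℝ, y = c • x := by
  have key : ∀ z ∈ P, ω.form z x ≠ 0 → ∃ c : ℝ, y = c • x := by
    intro z hz hzx
    refine ⟨-(ω.form y z / ω.form z x), ?_⟩
    have h1 := ω.cyclic x hx y hy z hz
    rw [h, zero_smul, zero_add] at h1
    have h2 : ω.form z x • y = -(ω.form y z • x) := by
      rw [eq_neg_iff_add_eq_zero, add_comm]; exact h1
    calc y = (ω.form z x)⁻¹ • (ω.form z x • y) := by rw [smul_smul, inv_mul_cancel₀ hzx, one_smul]
      _ = _ := by rw [h2, smul_neg, smul_smul, neg_smul, div_eq_inv_mul]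
  obtain ⟨u, hu, v, hv, huv⟩ := ω.nondeg
  by_cases h1 : ω.form u x = 0
  · by_cases h2 : ω.form v x = 0
    · exfalso
      have h3 := ω.cyclic u hu v hv x hx
      rw [h2, ω.skew x u, h1] at h3
      simp only [zero_smul, neg_zero, add_zero, smul_eq_zero] at h3
      exact h3.elim huv hx0
    · exact key v hv h2
  · exact key u hu h1

theorem eq_smul_add_smul {x y z : E} (hx : x ∈ P) (hy : y ∈ P) (hz : z ∈ P)
    (h : ω.form x y ≠ 0) :
    z = (ω.form z y / ω.form x y) • x + (ω.form x z / ω.form x y) • y := by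
  have h1 := ω.cyclic x hx y hy z hz
  rw [ω.skew y z, ω.skew z x] at h1
  calc z = (ω.form x y)⁻¹ • (ω.form x y • z) := by rw [smul_smul, inv_mul_cancel₀ h, one_smul]
    _ = (ω.form x y)⁻¹ • (ω.form z y • x + ω.form x z • y) := by
      congr 1
      rw [← sub_eq_zero, ← h1]
      module
    _ = _ := by rw [smul_add, smul_smul, smul_smul, div_eq_inv_mul, div_eq_inv_mul]

/-- The area form of opposite sign. -/
def neg : PlaneForm P where
  form := -ω.form
  alt x := by simp [ω.alt]
  cyclic x hx y hy z hz := by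
    have h := ω.cyclic x hx y hy z hz
    simp only [LinearMap.neg_apply, neg_smul]
    rw [← neg_eq_zero, ← h]
    module
  nondeg := by
    obtain ⟨u, hu, v, hv, huv⟩ := ω.nondeg
    exact ⟨u, hu, v, hv, by simpa using huv⟩

theorem neg_form (x y : E) : ω.neg.form x y = -ω.form x y := rfl

/-- The form is the two-by-two determinant of the coordinates supplied by a left inverse of the
basis map. -/
theorem exists_of_linearIndependent {u v : E} (h : LinearIndependent ℝ ![u, v]) :
    Nonempty (PlaneForm (Submodule.span ℝ {u, v})) := by
  obtain ⟨g, hg⟩ := LinearMap.exists_leftInverse_of_injective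
    (Fintype.linearCombination ℝ ![u, v]) (by
      rw [LinearMap.ker_eq_bot']
      intro c hc
      funext i
      exact Fintype.linearIndependent_iff.mp h c
        (by simpa [Fintype.linearCombination_apply] using hc) i)
  have hgu : g u = Pi.single 0 1 := by
    have := congrArg (fun f => f (Pi.single 0 1)) hg
    simpa [Fintype.linearCombination_apply, Fin.sum_univ_two] using this
  have hgv : g v = Pi.single 1 1 := by
    have := congrArg (fun f => f (Pi.single 1 1)) hg
    simpa [Fintype.linearCombination_apply, Fin.sum_univ_two] using this
  let f0 : E →ₗ[ℝ] ℝ := LinearMap.proj 0 ∘ₗ g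
  let f1 : E →ₗ[ℝ] ℝ := LinearMap.proj 1 ∘ₗ g
  have h0u : f0 u = 1 := by simp [f0, hgu]
  have h1u : f1 u = 0 := by simp [f1, hgu]
  have h0v : f0 v = 0 := by simp [f0, hgv]
  have h1v : f1 v = 1 := by simp [f1, hgv]
  refine ⟨⟨f0.smulRight f1 - f1.smulRight f0, fun x => ?_, fun x hx y hy z hz => ?_,
    u, Submodule.subset_span (by simp), v, Submodule.subset_span (by simp), ?_⟩⟩
  · simp [mul_comm]
  · obtain ⟨a, a', rfl⟩ := Submodule.mem_span_pair.mp hx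
    obtain ⟨b, b', rfl⟩ := Submodule.mem_span_pair.mp hy
    obtain ⟨c, c', rfl⟩ := Submodule.mem_span_pair.mp hz
    simp only [LinearMap.sub_apply, LinearMap.smulRight_apply, LinearMap.smul_apply,
      LinearMap.add_apply, map_add, map_smul, h0u, h1u, h0v, h1v, smul_eq_mul]
    module
  · simp [h0u, h1u, h1v]

end PlaneForm

/-! ### Dihedral reflection subgroups and their simple roots. -/

namespace CoxeterSystem

variable {B W : Type*} [Group W] {M : CoxeterMatrix B} (cs : CoxeterSystem M W)

/-- The roots in a subspace. -/
def rootsIn (P : Submodule ℝ M.RootSpace) : Set M.RootSpace := {d | cs.IsRoot d ∧ d ∈ P}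

variable {cs} {P : Submodule ℝ M.RootSpace}

theorem isReflectionClosed_rootsIn : cs.IsReflectionClosed (cs.rootsIn P) where
  isRoot _ h := h.1
  neg _ h := ⟨h.1.neg, P.neg_mem h.2⟩
  refl d h d' h' := ⟨h'.1.geomRep _, by
    rw [h.1.rootReflection_apply]
    exact P.sub_mem h'.2 (P.smul_mem _ h.2)⟩

/-- The product of three reflections in coplanar roots is a reflection in a root of that plane. -/
theorem exists_rootReflection_eq_mul_mul (ω : PlaneForm P) {a b c : M.RootSpace}
    (ha : a ∈ cs.rootsIn P) (hb : b ∈ cs.rootsIn P) (hc : c ∈ cs.rootsIn P) :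
    ∃ d ∈ cs.rootsIn P,
      cs.rootReflection a * cs.rootReflection b * cs.rootReflection c = cs.rootReflection d := by
  by_cases hab : ω.form a b = 0
  · obtain ⟨k, hk⟩ := ω.exists_smul ha.2 hb.2 ha.1.ne_zero hab
    refine ⟨c, hc, ?_⟩
    have : cs.rootReflection b = cs.rootReflection a := by
      rcases ha.1.eq_or_eq_neg_of_smul hb.1.form_self hk with rfl | rfl
      · rfl
      · exact ha.1.rootReflection_neg
    rw [this, ha.1.mul_self, one_mul]
  · have hcab := ω.eq_smul_add_smul ha.2 hb.2 hc.2 hab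
    set p := ω.form c b / ω.form a b
    set q := ω.form a c / ω.form a b
    set κ := M.form a b with hκ
    have haa := ha.1.form_self
    have hbb := hb.1.form_self
    have hba : M.form b a = κ := M.form_symm b a
    have hN : p * p + q * q + 2 * p * q * κ = 1 := by
      have := hc.1.form_self
      rw [hcab] at this
      simp only [map_add, map_smul, LinearMap.add_apply, LinearMap.smul_apply, smul_eq_mul,
        haa, hbb, hba, ← hκ] at this
      linarith
    -- `d` is the image of `c = p a + q b` under the map `b ↦ a`, `a ↦ 2κa - b`, whose square is the
    -- product of the reflections in `a` and `b` on their span.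
    set d := (2 * p * κ + q) • a - p • b with hd
    have hdd : M.form d d = 1 := by
      simp only [hd, map_sub, map_smul, LinearMap.sub_apply, LinearMap.smul_apply, smul_eq_mul,
        haa, hbb, hba, ← hκ]
      linear_combination hN
    have hact : ∀ v, cs.geomRep
        (cs.rootReflection a * cs.rootReflection b * cs.rootReflection c) v =
          v - (2 * M.form d v) • d := by
      intro v
      simp only [geomRep_mul_apply, ha.1.rootReflection_apply, hb.1.rootReflection_apply,
        hc.1.rootReflection_apply]
      rw [hcab, hd]
      simp only [map_add, map_sub, map_smul, LinearMap.add_apply, LinearMap.sub_apply,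
        LinearMap.smul_apply, smul_eq_mul, haa, hbb, hba, ← hκ]
      match_scalars
      · ring
      · linear_combination (2 * M.form a v - 4 * κ * M.form b v) * hN
      · linear_combination (2 * M.form b v) * hN
    have hdr := cs.isRoot_of_geomRep_apply hdd hact
    exact ⟨d, ⟨hdr, P.sub_mem (P.smul_mem _ ha.2) (P.smul_mem _ hb.2)⟩,
      hdr.eq_rootReflection hact⟩

/-- A positive root of the plane `P` is extreme with respect to `ω` if no positive root of `P`
lies beyond it. -/
def IsExtreme (cs : CoxeterSystem M W) (ω : PlaneForm P) (e : M.RootSpace) : Prop :=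
  (e ∈ cs.rootsIn P ∧ 0 < M.height e) ∧
    ∀ d ∈ cs.rootsIn P, 0 < M.height d → 0 ≤ ω.form d e

/-- The plane may contain infinitely many roots, so a last one need not be evident. Acuteness makes
every positive root on this side of `a` an inversion of the reflection in `a`: otherwise its mirror
image would be positive, on the same side and not acute. So they are finite in number, and one
maximizing `ω a d / height d` is extreme by the cyclic identity. -/
theorem exists_isExtreme_of_acute (ω : PlaneForm P) {a : M.RootSpace} (ha : a ∈ cs.rootsIn P)
    (ha0 : 0 < M.height a)
    (h : ∀ d ∈ cs.rootsIn P, 0 < M.height d → 0 < ω.form a d → 0 < M.form a d) :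
    ∃ e, cs.IsExtreme ω e := by
  classical
  let S : Set M.RootSpace := insert a {d | (d ∈ cs.rootsIn P ∧ 0 < M.height d) ∧ 0 < ω.form a d}
  have hfin : S.Finite := by
    refine Set.Finite.insert a (((isReflectionClosed_rootsIn (cs := cs) (P := P)).finite_inversions
      (cs.rootReflection a)).subset ?_)
    rintro d ⟨⟨hd, hd0⟩, hpos⟩
    refine ⟨hd, hd0, ?_⟩
    by_contra hcon
    have hmem := isReflectionClosed_rootsIn.refl a ha d hd
    have h0 := lt_of_le_of_ne (not_lt.mp hcon) hmem.1.height_ne_zero.symm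
    have h1 : ω.form a (cs.geomRep (cs.rootReflection a) d) = ω.form a d := by
      rw [ha.1.rootReflection_apply, map_sub, map_smul, ω.alt, smul_zero, sub_zero]
    have h2 : M.form a (cs.geomRep (cs.rootReflection a) d) = -M.form a d := by
      rw [ha.1.rootReflection_apply, map_sub, map_smul, ha.1.form_self, smul_eq_mul]
      ring
    have h3 := h _ hmem h0 (by rwa [h1])
    have h4 := h d hd hd0 hpos
    rw [h2] at h3
    linarith
  have hS : ∀ d ∈ S, d ∈ cs.rootsIn P ∧ 0 < M.height d := by
    rintro d (rfl | hd)
    · exact ⟨ha, ha0⟩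
    · exact hd.1
  have haS : a ∈ S := Set.mem_insert _ _
  obtain ⟨e, he, hmax⟩ := Set.exists_max_image S (fun d => ω.form a d / M.height d) hfin ⟨a, haS⟩
  obtain ⟨heP, he0⟩ := hS e he
  refine ⟨e, ⟨heP, he0⟩, fun d hd hd0 => ?_⟩
  have hae : 0 ≤ ω.form a e := by
    have := hmax a haS
    simp only [ω.alt, zero_div] at this
    exact (div_nonneg_iff.mp this).elim (fun h => h.1) (fun h => absurd he0 h.2.not_gt)
  have hle : ω.form a d * M.height e ≤ ω.form a e * M.height d := by
    by_cases hpos : 0 < ω.form a d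
    · have := hmax d (Or.inr ⟨⟨hd, hd0⟩, hpos⟩)
      rwa [div_le_div_iff₀ hd0 he0] at this
    · nlinarith [mul_nonneg hae hd0.le]
  have hcyc := congrArg M.height (ω.cyclic a ha.2 d hd.2 e heP.2)
  simp only [map_add, map_smul, smul_eq_mul, map_zero, ω.skew e a] at hcyc
  by_contra hneg
  nlinarith

/-- A positive root cannot have roots at a non-acute angle on both of its sides. -/
theorem not_obtuse_both_sides (ω : PlaneForm P) {a d d' : M.RootSpace} (ha : a ∈ cs.rootsIn P)
    (ha0 : 0 < M.height a) (hd : d ∈ P) (hd0 : 0 < M.height d)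
    (hd' : d' ∈ P) (hd0' : 0 < M.height d') (h1 : 0 < ω.form a d)
    (h2 : ω.form a d' < 0) (h3 : M.form a d ≤ 0) (h4 : M.form a d' ≤ 0) : False := by
  -- Pairing this relation with `a` gives `ω d d' ≥ 0`; it then becomes a vanishing nonnegative
  -- combination of positive heights with a nonzero coefficient.
  have hcyc := ω.cyclic a ha.2 d hd d' hd'
  rw [ω.skew d' a] at hcyc
  have e1 := congrArg M.height hcyc
  have e2 := congrArg (M.form a) hcyc
  simp only [map_add, map_smul, smul_eq_mul, map_zero, ha.1.form_self] at e1 e2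
  have h5 : 0 ≤ ω.form d d' := by nlinarith
  nlinarith [mul_pos h1 hd0', mul_nonneg h5 ha0.le]

theorem exists_isExtreme_or (ω : PlaneForm P) {a : M.RootSpace} (ha : a ∈ cs.rootsIn P)
    (ha0 : 0 < M.height a) : (∃ e, cs.IsExtreme ω e) ∨ ∃ e, cs.IsExtreme ω.neg e := by
  by_cases h : ∀ d ∈ cs.rootsIn P, 0 < M.height d → 0 < ω.form a d → 0 < M.form a d
  · exact Or.inl (exists_isExtreme_of_acute ω ha ha0 h)
  · refine Or.inr (exists_isExtreme_of_acute ω.neg ha ha0 fun d hd hd0 hpos => ?_)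
    rw [PlaneForm.neg_form] at hpos
    push Not at h
    obtain ⟨d', hd', hd0', h1, h2⟩ := h
    by_contra hcon
    exact not_obtuse_both_sides ω ha ha0 hd'.2 hd0' hd.2 hd0 h1 (by linarith) h2 (not_lt.mp hcon)

namespace IsExtreme

variable {ω : PlaneForm P} {e : M.RootSpace}

/-- The reflection in an extreme root makes no other positive root of the plane negative. -/
theorem eq_of_height_neg (he : cs.IsExtreme ω e) {d : M.RootSpace} (hd : d ∈ cs.rootsIn P)
    (hd0 : 0 < M.height d) (hneg : M.height (cs.geomRep (cs.rootReflection e) d) < 0) :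
    d = e := by
  have hmem := isReflectionClosed_rootsIn.neg _ (isReflectionClosed_rootsIn.refl e he.1.1 d hd)
  have h1 := he.2 _ hmem (by rw [map_neg]; linarith)
  have h2 := he.2 d hd hd0
  rw [he.1.1.1.rootReflection_apply, map_neg, LinearMap.neg_apply, map_sub, map_smul,
    LinearMap.sub_apply, LinearMap.smul_apply, ω.alt, smul_zero, sub_zero] at h1
  have h3 : ω.form e d = 0 := by
    rw [ω.skew]; linarith
  obtain ⟨c, hc⟩ := ω.exists_smul he.1.1.2 hd.2 he.1.1.1.ne_zero h3
  exact he.1.1.1.eq_of_smul hd.1 he.1.2 hd0 hc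

/-- A reflection has determinant `-1` on the plane. -/
theorem form_reflection (he : cs.IsExtreme ω e) {x y : M.RootSpace} (hx : x ∈ P) (hy : y ∈ P) :
    ω.form (cs.geomRep (cs.rootReflection e) x) (cs.geomRep (cs.rootReflection e) y) =
      -ω.form x y := by
  have hcyc := congrArg (M.form e) (ω.cyclic x hx y hy e he.1.1.2)
  have h1 := ω.skew e y
  have h2 := ω.skew e x
  simp only [map_add, map_smul, smul_eq_mul, map_zero, he.1.1.1.form_self] at hcyc
  simp only [he.1.1.1.rootReflection_apply, map_sub, map_smul, LinearMap.sub_apply,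
    LinearMap.smul_apply, smul_eq_mul, ω.alt]
  linear_combination 2 * hcyc - 2 * M.form e x * h1 - 2 * M.form e y * h2

/-- If `a` has a non-acute root on the far side, use the mirror image of `a` under the reflection in
`e` instead. That reflection swaps the sides and preserves positivity of roots other than `e`, so a
non-acute root there would reflect to one on the near side of `a`, giving `a` obstructions on both
sides. -/
theorem exists_neg (he : cs.IsExtreme ω e) {a : M.RootSpace} (ha : a ∈ cs.rootsIn P)
    (ha0 : 0 < M.height a) (hae : a ≠ e) : ∃ e', cs.IsExtreme ω.neg e' := by
  by_cases h : ∀ d ∈ cs.rootsIn P, 0 < M.height d → 0 < ω.neg.form a d → 0 < M.form a d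
  · exact exists_isExtreme_of_acute ω.neg ha ha0 h
  · push Not at h
    obtain ⟨d', hd', hd0', h1, h2⟩ := h
    rw [PlaneForm.neg_form] at h1
    have hpos : ∀ d ∈ cs.rootsIn P, 0 < M.height d → d ≠ e →
        0 < M.height (cs.geomRep (cs.rootReflection e) d) := by
      intro d hd hd0 hde
      by_contra hcon
      exact hde (he.eq_of_height_neg hd hd0
        (lt_of_le_of_ne (not_lt.mp hcon) (hd.1.geomRep _).height_ne_zero))
    have ham := isReflectionClosed_rootsIn.refl e he.1.1 a ha
    refine exists_isExtreme_of_acute ω.neg ham (hpos a ha ha0 hae) fun d hd hd0 hneg => ?_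
    rw [PlaneForm.neg_form] at hneg
    by_contra hcon
    have hde : d ≠ e := by
      rintro rfl
      have := he.2 _ ham (hpos a ha ha0 hae)
      linarith
    have hdm := isReflectionClosed_rootsIn.refl e he.1.1 d hd
    have hinv := IsReflectionClosed.rootReflection_rootReflection he.1.1.1 a
    refine not_obtuse_both_sides ω ha ha0 hdm.2 (hpos d hd hd0 hde) hd'.2 hd0' ?_
      (by linarith) ?_ h2
    · rw [← hinv, he.form_reflection ham.2 hd.2]
      linarith
    · rw [← hinv, form_geomRep]
      exact not_lt.mp hcon

end IsExtreme

/-- The positive roots in a plane are spanned by two of them. -/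
theorem exists_simple_pair (ω : PlaneForm P) {a b : M.RootSpace} (ha : a ∈ cs.rootsIn P)
    (hb : b ∈ cs.rootsIn P) (ha0 : 0 < M.height a) (hb0 : 0 < M.height b) (hab : a ≠ b) :
    ∃ e₁ e₂, e₁ ≠ e₂ ∧
      (∀ e, e = e₁ ∨ e = e₂ → (e ∈ cs.rootsIn P ∧ 0 < M.height e) ∧
        ∀ d ∈ cs.rootsIn P, 0 < M.height d →
          M.height (cs.geomRep (cs.rootReflection e) d) < 0 → d = e) ∧
      ∀ d ∈ cs.rootsIn P, 0 < M.height d →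
        ∃ p q : ℝ, 0 ≤ p ∧ 0 ≤ q ∧ d = p • e₁ + q • e₂ := by
  have key : ∀ ω : PlaneForm P, (∃ e, cs.IsExtreme ω e) → ∃ e, cs.IsExtreme ω.neg e := by
    rintro ω ⟨e, he⟩
    by_cases hae : a = e
    · exact he.exists_neg hb hb0 (fun h => hab (hae.trans h.symm))
    · exact he.exists_neg ha ha0 hae
  have hnn : ω.neg.neg = ω := by
    cases ω
    simp only [PlaneForm.neg, PlaneForm.mk.injEq]
    ext : 2
    simp
  obtain ⟨e₂, h₂⟩ : ∃ e, cs.IsExtreme ω e := by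
    rcases exists_isExtreme_or ω ha ha0 with h | h
    · exact h
    · rw [← hnn]; exact key _ h
  obtain ⟨e₁, h₁⟩ := key ω ⟨e₂, h₂⟩
  have h₁' : ∀ d ∈ cs.rootsIn P, 0 < M.height d → 0 ≤ ω.form e₁ d := fun d hd hd0 => by
    rw [ω.skew]; exact h₁.2 d hd hd0
  have h0 : ω.form e₁ e₂ ≠ 0 := by
    intro h0
    obtain ⟨c, hc⟩ := ω.exists_smul h₁.1.1.2 h₂.1.1.2 h₁.1.1.1.ne_zero h0
    have he := h₁.1.1.1.eq_of_smul h₂.1.1.1 h₁.1.2 h₂.1.2 hc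
    have hall : ∀ d ∈ cs.rootsIn P, 0 < M.height d → d = e₁ := by
      intro d hd hd0
      have h3 := h₁' d hd hd0
      have h4 := h₂.2 d hd hd0
      rw [he, ω.skew] at h4
      obtain ⟨c, hc⟩ := ω.exists_smul h₁.1.1.2 hd.2 h₁.1.1.1.ne_zero (by linarith)
      exact h₁.1.1.1.eq_of_smul hd.1 h₁.1.2 hd0 hc
    exact hab ((hall a ha ha0).trans (hall b hb hb0).symm)
  have hpos : 0 < ω.form e₁ e₂ := lt_of_le_of_ne (h₁' e₂ h₂.1.1 h₂.1.2) h0.symm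
  refine ⟨e₁, e₂, ?_, ?_, ?_⟩
  · rintro rfl
    exact h0 (ω.alt _)
  · rintro e (rfl | rfl)
    · exact ⟨h₁.1, fun d => h₁.eq_of_height_neg⟩
    · exact ⟨h₂.1, fun d => h₂.eq_of_height_neg⟩
  · intro d hd hd0
    exact ⟨_, _, div_nonneg (h₂.2 d hd hd0) hpos.le, div_nonneg (h₁' d hd hd0) hpos.le,
      ω.eq_smul_add_smul h₁.1.1.2 h₂.1.1.2 hd.2 h0⟩

end CoxeterSystem

/-! ### Edges of the Bruhat graph -/

namespace CoxeterSystem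

variable {B W : Type*} [Group W] {M : CoxeterMatrix B} {cs : CoxeterSystem M W}

theorem bruhatStep_iff {x y : W} : cs.BruhatStep x y ↔
    ∃ r, cs.IsRoot r ∧ 0 < M.height r ∧ 0 < M.height (cs.geomRep x r) ∧
      y = x * cs.rootReflection r := by
  constructor
  · rintro ⟨⟨t, ht, rfl⟩, hl⟩
    obtain ⟨r, hr, hr0, h⟩ := (ht.conj x⁻¹).exists_root
    have he : t * x = x * cs.rootReflection r := by rw [← h]; group
    exact ⟨r, hr, hr0, (cs.length_lt_mul_rootReflection_iff hr hr0).mp (he ▸ hl), he⟩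
  · rintro ⟨r, hr, hr0, hx, rfl⟩
    exact ⟨⟨_, hr.isReflection.conj x, by group⟩,
      (cs.length_lt_mul_rootReflection_iff hr hr0).mpr hx⟩

theorem bruhatStep_mul_rootReflection_iff {x : W} {r : M.RootSpace} (hr : cs.IsRoot r) :
    cs.BruhatStep x (x * cs.rootReflection r) ↔
      cs.length x < cs.length (x * cs.rootReflection r) :=
  ⟨fun h => h.2, fun h => ⟨⟨_, hr.isReflection.conj x, by group⟩, h⟩⟩

/-- The orientation of an edge of the Bruhat graph can be read off from relative lengths. -/
theorem IsReflectionClosed.bruhatStep {Ψ : Set M.RootSpace} (hΨ : cs.IsReflectionClosed Ψ)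
    {x : W} {r : M.RootSpace} (hr : r ∈ Ψ)
    (hl : cs.relLength Ψ x < cs.relLength Ψ (x * cs.rootReflection r)) :
    cs.BruhatStep x (x * cs.rootReflection r) := by
  have hrr := hΨ.isRoot r hr
  rw [bruhatStep_mul_rootReflection_iff hrr]
  rcases lt_or_gt_of_ne hrr.height_ne_zero with h | h
  · have h' : 0 < M.height (-r) := by rw [map_neg]; linarith
    rw [← hrr.rootReflection_neg] at hl ⊢
    rw [cs.length_lt_mul_rootReflection_iff hrr.neg h']
    exact (hΨ.relLength_lt_mul_iff (hΨ.neg r hr) h').mp hl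
  · rw [cs.length_lt_mul_rootReflection_iff hrr h]
    exact (hΨ.relLength_lt_mul_iff hr h).mp hl

/-- Under two distinct involutions changing a level by one, there are two elements on every level
that is neither lowest nor above a top element. -/
theorem exists_two_of_level {G : Type*} [Group G] {C : Set G} {L : G → ℕ} {r₁ r₂ : G}
    (hne : r₁ ≠ r₂) (hC : ∀ z ∈ C, z * r₁ ∈ C ∧ z * r₂ ∈ C)
    (hinv : r₁ * r₁ = 1 ∧ r₂ * r₂ = 1)
    (hL₁ : ∀ z ∈ C, L (z * r₁) = L z + 1 ∨ L z = L (z * r₁) + 1)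
    (hL₂ : ∀ z ∈ C, L (z * r₂) = L z + 1 ∨ L z = L (z * r₂) + 1) {N : ℕ}
    (htop : ∀ z ∈ C, L (z * r₁) < L z → L (z * r₂) < L z → N ≤ L z)
    {x : G} (hx : x ∈ C) {n : ℕ} (hxn : L x < n) (hn : n < N) :
    ∃ a ∈ C, ∃ b ∈ C, a ≠ b ∧ L a = n ∧ L b = n := by
  obtain ⟨z, hz, hmin⟩ : ∃ z ∈ C, ∀ z' ∈ C, L z ≤ L z' := by
    have hne' : (L '' C).Nonempty := ⟨_, x, hx, rfl⟩
    obtain ⟨z, hz, he⟩ := Nat.sInf_mem hne'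
    exact ⟨z, hz, fun z' hz' => he ▸ Nat.sInf_le ⟨z', hz', rfl⟩⟩
  have hzn : L z + 1 ≤ n := (hmin x hx).trans_lt hxn
  clear hxn
  induction n, hzn using Nat.le_induction with
  | base =>
    have h₁ := hmin _ (hC z hz).1
    have h₂ := hmin _ (hC z hz).2
    refine ⟨z * r₁, (hC z hz).1, z * r₂, (hC z hz).2, fun h => hne (mul_left_cancel h), ?_, ?_⟩
    · rcases hL₁ z hz with h | h <;> omega
    · rcases hL₂ z hz with h | h <;> omega
  | succ m hm ih =>
    obtain ⟨a, ha, b, hb, hab, hla, hlb⟩ := ih (by omega)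
    have hup : ∀ c ∈ C, L c = m → L (c * r₁) = m + 1 ∨ L (c * r₂) = m + 1 := by
      intro c hc hlc
      by_contra! hcon
      have h₁ := hL₁ c hc
      have h₂ := hL₂ c hc
      have := htop c hc (by omega) (by omega)
      omega
    have hmix : ∀ a ∈ C, ∀ b ∈ C, L a = m → L b = m → L (a * r₁) = m + 1 → a * r₁ ≠ b * r₂ := by
      intro a ha b hb hla hlb h he
      have e1 : a * r₁ * r₁ = a := by rw [mul_assoc, hinv.1, mul_one]
      have e2 : a * r₁ * r₂ = b := by rw [he, mul_assoc, hinv.2, mul_one]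
      have := htop (a * r₁) (hC a ha).1 (by rw [e1]; omega) (by rw [e2]; omega)
      omega
    rcases hup a ha hla with h₁ | h₁ <;> rcases hup b hb hlb with h₂ | h₂
    · exact ⟨_, (hC a ha).1, _, (hC b hb).1, fun h => hab (mul_right_cancel h), h₁, h₂⟩
    · exact ⟨_, (hC a ha).1, _, (hC b hb).2, hmix a ha b hb hla hlb h₁, h₁, h₂⟩
    · exact ⟨_, (hC a ha).2, _, (hC b hb).1, (hmix b hb a ha hlb hla h₂).symm, h₁, h₂⟩
    · exact ⟨_, (hC a ha).2, _, (hC b hb).2, fun h => hab (mul_right_cancel h), h₁, h₂⟩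

theorem linearIndependent_of_ne {d r : M.RootSpace} (hd : cs.IsRoot d) (hr : cs.IsRoot r)
    (hd0 : 0 < M.height d) (hr0 : 0 < M.height r) (hdr : d ≠ r) :
    LinearIndependent ℝ ![r, d] := by
  rw [LinearIndependent.pair_iff' hr.ne_zero]
  intro c hc
  exact hdr (hr.eq_of_smul hd hr0 hd0 hc.symm)

/-- An edge of the Bruhat graph joining elements whose lengths differ by at least three is the
long edge of a hexagon of edges. -/
theorem BruhatStep.exists_hexagon {x y : W} (h : cs.BruhatStep x y)
    (h3 : cs.length x + 3 ≤ cs.length y) :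
    ∃ a a' b b' : W, a ≠ a' ∧ b ≠ b' ∧ cs.BruhatStep x a ∧ cs.BruhatStep x a' ∧
      cs.BruhatStep a b ∧ cs.BruhatStep a b' ∧ cs.BruhatStep a' b ∧ cs.BruhatStep a' b' ∧
      cs.BruhatStep b y ∧ cs.BruhatStep b' y := by
  obtain ⟨r, hr, hr0, hxr, rfl⟩ := bruhatStep_iff.mp h
  obtain ⟨d, hd, hdr⟩ : ∃ d ∈ cs.newInversions {d | cs.IsRoot d} x r, d ≠ r := by
    rw [← relLength_isRoot, ← relLength_isRoot,
      cs.isReflectionClosed_isRoot.relLength_mul_rootReflection hr hr0 hxr] at h3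
    exact Set.exists_ne_of_one_lt_ncard (by omega) r
  have hdroot : cs.IsRoot d := hd.1
  obtain ⟨ω⟩ := PlaneForm.exists_of_linearIndependent
    (linearIndependent_of_ne hdroot hr hd.2.1 hr0 hdr)
  set P := Submodule.span ℝ {r, d}
  have hΨ : cs.IsReflectionClosed (cs.rootsIn P) := isReflectionClosed_rootsIn
  have hrP : r ∈ cs.rootsIn P := ⟨hr, Submodule.subset_span (by simp)⟩
  have hdP : d ∈ cs.rootsIn P := ⟨hdroot, Submodule.subset_span (by simp)⟩
  have hL := hΨ.add_three_le_relLength_mul hrP hr0 hxr (d := d) ⟨hdP, hd.2⟩ hdr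
  obtain ⟨e₁, e₂, hne, he, hcone⟩ := exists_simple_pair ω hdP hrP hd.2.1 hr0 hdr
  obtain ⟨⟨h₁, h₁0⟩, h₁s⟩ := he e₁ (Or.inl rfl)
  obtain ⟨⟨h₂, h₂0⟩, h₂s⟩ := he e₂ (Or.inr rfl)
  set L := cs.relLength (cs.rootsIn P) with hLdef
  have hstep : ∀ e ∈ cs.rootsIn P, 0 < M.height e → (∀ d ∈ cs.rootsIn P, 0 < M.height d →
      M.height (cs.geomRep (cs.rootReflection e) d) < 0 → d = e) → ∀ z,
      L (z * cs.rootReflection e) = L z + 1 ∨ L z = L (z * cs.rootReflection e) + 1 := by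
    intro e he he0 hes z
    rcases lt_or_gt_of_ne (he.1.geomRep z).height_ne_zero with h | h
    · right
      have := hΨ.relLength_mul_simple (z := z * cs.rootReflection e) he he0 hes (by
        rw [geomRep_mul_apply, he.1.rootReflection_self, map_neg, map_neg]
        linarith)
      rwa [mul_assoc, he.1.mul_self, mul_one] at this
    · exact Or.inl (hΨ.relLength_mul_simple he he0 hes h)
  -- If `z` makes both simple roots of the plane negative, it makes their whole cone negative, so
  -- its relative length is maximal.
  have htop : ∀ z, L (z * cs.rootReflection e₁) < L z → L (z * cs.rootReflection e₂) < L z →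
      L (x * cs.rootReflection r) ≤ L z := by
    intro z hz₁ hz₂
    have hneg : ∀ e ∈ cs.rootsIn P, 0 < M.height e → L (z * cs.rootReflection e) < L z →
        M.height (cs.geomRep z e) < 0 := by
      intro e he he0 hlt
      by_contra hcon
      exact absurd hlt (hΨ.relLength_lt_mul he he0 (lt_of_le_of_ne (not_lt.mp hcon)
        (he.1.geomRep z).height_ne_zero.symm)).not_gt
    have hz₁' := hneg e₁ h₁ h₁0 hz₁
    have hz₂' := hneg e₂ h₂ h₂0 hz₂
    refine Set.ncard_le_ncard (fun c hc => ⟨hc.1, hc.2.1, ?_⟩) (hΨ.finite_inversions z)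
    obtain ⟨p, q, hp, hq, hpq⟩ := hcone c hc.1 hc.2.1
    refine lt_of_le_of_ne ?_ (hc.1.1.geomRep z).height_ne_zero
    rw [hpq]
    simp only [map_add, map_smul, smul_eq_mul]
    nlinarith
  let odd : W → Prop := fun z => ∃ d ∈ cs.rootsIn P, z = x * cs.rootReflection d
  let even : W → Prop := fun z => ∃ d ∈ cs.rootsIn P, ∃ d' ∈ cs.rootsIn P,
    z = x * cs.rootReflection d * cs.rootReflection d'
  have hodd : ∀ z, odd z → ∀ e ∈ cs.rootsIn P, even (z * cs.rootReflection e) := by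
    rintro z ⟨d, hd, rfl⟩ e he
    exact ⟨d, hd, e, he, rfl⟩
  have heven : ∀ z, even z → ∀ e ∈ cs.rootsIn P, odd (z * cs.rootReflection e) := by
    rintro z ⟨d, hd, d', hd', rfl⟩ e he
    obtain ⟨c, hc, hc'⟩ := exists_rootReflection_eq_mul_mul ω hd hd' he
    exact ⟨c, hc, by rw [← hc']; group⟩
  -- Recording the parity of `L` lets the level of an element decide whether it is `x` times one
  -- reflection or times two.
  let C : Set W := {z | (odd z ∧ L z % 2 = (L x + 1) % 2) ∨ (even z ∧ L z % 2 = L x % 2)}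
  have hCmul : ∀ e ∈ cs.rootsIn P, (∀ z, L (z * cs.rootReflection e) = L z + 1 ∨
      L z = L (z * cs.rootReflection e) + 1) → ∀ z ∈ C, z * cs.rootReflection e ∈ C := by
    rintro e he hstep z (⟨hz, hz'⟩ | ⟨hz, hz'⟩)
    · exact Or.inr ⟨hodd z hz e he, by have := hstep z; omega⟩
    · exact Or.inl ⟨heven z hz e he, by have := hstep z; omega⟩
  have hs₁ := hstep e₁ h₁ h₁0 h₁s
  have hs₂ := hstep e₂ h₂ h₂0 h₂s
  have hxC : x ∈ C := Or.inr ⟨⟨r, hrP, r, hrP, by rw [mul_assoc, hr.mul_self, mul_one]⟩, rfl⟩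
  have hlevel : ∀ n, L x < n → n < L (x * cs.rootReflection r) →
      ∃ a ∈ C, ∃ b ∈ C, a ≠ b ∧ L a = n ∧ L b = n := fun n h1 h2 =>
    exists_two_of_level (r₁ := cs.rootReflection e₁) (r₂ := cs.rootReflection e₂)
      (fun h => hne (h₁.1.eq_of_rootReflection_eq h₂.1 h₁0 h₂0 h).symm)
      (fun z hz => ⟨hCmul e₁ h₁ hs₁ z hz, hCmul e₂ h₂ hs₂ z hz⟩)
      ⟨h₁.1.mul_self, h₂.1.mul_self⟩ (fun z _ => hs₁ z) (fun z _ => hs₂ z)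
      (fun z _ => htop z) hxC h1 h2
  obtain ⟨a, ha, a', ha', haa, hla, hla'⟩ := hlevel (L x + 1) (by omega) (by omega)
  obtain ⟨b, hb, b', hb', hbb, hlb, hlb'⟩ := hlevel (L x + 2) (by omega) (by omega)
  have hCodd : ∀ z ∈ C, L z = L x + 1 → odd z := by
    rintro z (hz | hz) hl
    · exact hz.1
    · omega
  have hCeven : ∀ z ∈ C, L z = L x + 2 → even z := by
    rintro z (hz | hz) hl
    · omega
    · exact hz.1
  -- Elements of opposite kinds differ by a product of three reflections of the plane, hence by a
  -- single one.
  have hlink : ∀ z z', odd z → even z' →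
      (L z < L z' → cs.BruhatStep z z') ∧ (L z' < L z → cs.BruhatStep z' z) := by
    rintro z z' ⟨c, hc, rfl⟩ ⟨d, hd, d', hd', rfl⟩
    obtain ⟨c', hc', he⟩ := exists_rootReflection_eq_mul_mul ω hc hd hd'
    have e1 : x * cs.rootReflection d * cs.rootReflection d' =
        x * cs.rootReflection c * cs.rootReflection c' := by
      rw [← he]
      simp only [mul_assoc]
      rw [← mul_assoc (cs.rootReflection c) (cs.rootReflection c), hc.1.mul_self, one_mul]
    have e2 : x * cs.rootReflection c =
        x * cs.rootReflection d * cs.rootReflection d' * cs.rootReflection c' := by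
      rw [e1, mul_assoc _ (cs.rootReflection c'), hc'.1.mul_self, mul_one]
    constructor
    · intro h
      rw [e1] at h ⊢
      exact hΨ.bruhatStep hc' h
    · intro h
      rw [e2] at h ⊢
      exact hΨ.bruhatStep hc' h
  have hxa : ∀ a, odd a → L a = L x + 1 → cs.BruhatStep x a := by
    rintro a ⟨c, hc, rfl⟩ hl
    exact hΨ.bruhatStep hc (show L x < L (x * cs.rootReflection c) by omega)
  have oa := hCodd a ha hla
  have oa' := hCodd a' ha' hla'
  have eb := hCeven b hb hlb
  have eb' := hCeven b' hb' hlb'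
  have oy : odd (x * cs.rootReflection r) := ⟨r, hrP, rfl⟩
  exact ⟨a, a', b, b', haa, hbb, hxa a oa hla, hxa a' oa' hla',
    (hlink a b oa eb).1 (by omega), (hlink a b' oa eb').1 (by omega),
    (hlink a' b oa' eb).1 (by omega), (hlink a' b' oa' eb').1 (by omega),
    (hlink _ b oy eb).2 (by omega), (hlink _ b' oy eb').2 (by omega)⟩

/-- If a product of two distinct reflections in roots of a subspace is also the product of the
reflections in `c` and `d`, then `c` and `d` lie in that subspace. -/
theorem mem_of_mul_eq_mul {P : Submodule ℝ M.RootSpace} {a b c d : M.RootSpace}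
    (ha : a ∈ cs.rootsIn P) (hb : b ∈ cs.rootsIn P) (hc : cs.IsRoot c) (hd : cs.IsRoot d)
    (hne : cs.rootReflection a ≠ cs.rootReflection b)
    (h : cs.rootReflection a * cs.rootReflection b = cs.rootReflection c * cs.rootReflection d) :
    c ∈ cs.rootsIn P ∧ d ∈ cs.rootsIn P := by
  have key : ∀ {a b c d : M.RootSpace}, a ∈ cs.rootsIn P → b ∈ cs.rootsIn P → cs.IsRoot c →
      cs.IsRoot d → cs.rootReflection a ≠ cs.rootReflection b →
      cs.rootReflection a * cs.rootReflection b = cs.rootReflection c * cs.rootReflection d →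
      c ∈ P := by
    intro a b c d ha hb hc hd hne h
    have hprop : ∀ k : ℝ, c ≠ k • d := by
      intro k hk
      have : cs.rootReflection c = cs.rootReflection d := by
        rcases hd.eq_or_eq_neg_of_smul hc.form_self hk with rfl | rfl
        · rfl
        · exact hd.rootReflection_neg
      rw [this, hd.mul_self] at h
      exact hne (mul_eq_one_iff_eq_inv.mp h |>.trans (hb.1.isReflection.inv))
    -- The reflection in `d` fixes `v`, so the product moves `v` by a nonzero multiple of `c`;
    -- written with `a` and `b`, the displacement lies in `P`.
    obtain ⟨v, hdv, hcv⟩ := hc.exists_form_eq_zero hd hprop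
    have e := congrArg (fun w => cs.geomRep w v) h
    simp only [geomRep_mul_apply, hc.rootReflection_apply, hd.rootReflection_apply,
      ha.1.rootReflection_apply, hb.1.rootReflection_apply, hdv, mul_zero, zero_smul,
      sub_zero] at e
    have hmem : (2 * M.form c v) • c ∈ P := by
      have : (2 * M.form c v) • c = (2 * M.form b v) • b +
          (2 * M.form a (v - (2 * M.form b v) • b)) • a := by
        rw [← sub_eq_zero] at e ⊢
        rw [← e]
        module
      rw [this]
      exact P.add_mem (P.smul_mem _ hb.2) (P.smul_mem _ ha.2)
    exact (P.smul_mem_iff (mul_ne_zero two_ne_zero hcv)).mp hmem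
  refine ⟨⟨hc, key ha hb hc hd hne h⟩, hd, key hb ha hd hc hne.symm ?_⟩
  have := congrArg (fun w => w⁻¹) h
  simpa only [mul_inv_rev, ha.1.isReflection.inv, hb.1.isReflection.inv, hc.isReflection.inv,
    hd.isReflection.inv] using this

/-- A hexagon of edges of the Bruhat graph has a long edge. -/
theorem bruhatStep_of_hexagon {x y a a' b b' : W} (haa : a ≠ a') (hbb : b ≠ b')
    (hxa : cs.BruhatStep x a) (hxa' : cs.BruhatStep x a') (hab : cs.BruhatStep a b)
    (hab' : cs.BruhatStep a b') (ha'b : cs.BruhatStep a' b) (ha'b' : cs.BruhatStep a' b')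
    (hby : cs.BruhatStep b y) (hby' : cs.BruhatStep b' y) : cs.BruhatStep x y := by
  have hl : cs.length x < cs.length y := (hxa.2.trans hab.2).trans hby.2
  obtain ⟨c, hc, hc0, -, rfl⟩ := bruhatStep_iff.mp hxa
  obtain ⟨c', hc', hc0', -, rfl⟩ := bruhatStep_iff.mp hxa'
  obtain ⟨d, hd, hd0, -, rfl⟩ := bruhatStep_iff.mp hab
  obtain ⟨d', hd', hd0', -, rfl⟩ := bruhatStep_iff.mp hab'
  obtain ⟨f, hf, -, -, hfe⟩ := bruhatStep_iff.mp ha'b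
  obtain ⟨f', hf', -, -, hfe'⟩ := bruhatStep_iff.mp ha'b'
  obtain ⟨g, hg, -, -, rfl⟩ := bruhatStep_iff.mp hby
  obtain ⟨g', hg', -, -, hge⟩ := bruhatStep_iff.mp hby'
  have hswap : ∀ {z : W} {p q p' q' : M.RootSpace}, cs.IsRoot p → cs.IsRoot p' → cs.IsRoot q →
      cs.IsRoot q' → z * cs.rootReflection p * cs.rootReflection q =
        z * cs.rootReflection p' * cs.rootReflection q' →
      cs.rootReflection p' * cs.rootReflection p = cs.rootReflection q' * cs.rootReflection q := by
    intro z p q p' q' hp hp' hq hq' h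
    rw [mul_assoc, mul_assoc, mul_left_cancel_iff] at h
    calc cs.rootReflection p' * cs.rootReflection p
        = cs.rootReflection p' * (cs.rootReflection p * cs.rootReflection q) *
            cs.rootReflection q := by
          rw [mul_assoc, mul_assoc, hq.mul_self, mul_one]
      _ = _ := by rw [h, ← mul_assoc, hp'.mul_self, one_mul]
  have hcc : cs.rootReflection c' ≠ cs.rootReflection c := fun h => haa (by rw [h])
  have hdd : cs.rootReflection d' ≠ cs.rootReflection d := fun h => hbb (by rw [h])
  have hcne : c' ≠ c := fun h => hcc (by rw [h])
  obtain ⟨ω⟩ := PlaneForm.exists_of_linearIndependent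
    (linearIndependent_of_ne hc' hc hc0' hc0 hcne)
  set P := Submodule.span ℝ {c, c'}
  have hcP : c ∈ cs.rootsIn P := ⟨hc, Submodule.subset_span (by simp)⟩
  have hcP' : c' ∈ cs.rootsIn P := ⟨hc', Submodule.subset_span (by simp)⟩
  -- The two routes to `b` and to `b'` place `d` and `d'` in the plane of `c` and `c'`; the two
  -- routes from `a` to `y` then place `g` there too.
  have hdP := (mem_of_mul_eq_mul hcP' hcP hf hd hcc (hswap hc hc' hd hf hfe)).2
  have hdP' := (mem_of_mul_eq_mul hcP' hcP hf' hd' hcc (hswap hc hc' hd' hf' hfe')).2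
  have hgP := (mem_of_mul_eq_mul hdP' hdP hg' hg hdd (hswap hd hd' hg hg' hge)).2
  obtain ⟨k, hk, he⟩ := exists_rootReflection_eq_mul_mul ω hcP hdP hgP
  have hy : x * cs.rootReflection c * cs.rootReflection d * cs.rootReflection g =
      x * cs.rootReflection k := by
    rw [← he]; group
  rw [hy] at hl ⊢
  exact (bruhatStep_mul_rootReflection_iff hk.1).mpr hl

end CoxeterSystem

/-! ### Bruhat intervals -/

namespace CoxeterSystem

variable {B W : Type*} [Group W] {M : CoxeterMatrix B} {cs : CoxeterSystem M W}
variable {B' W' : Type*} [Group W'] {M' : CoxeterMatrix B'} {cs' : CoxeterSystem M' W'}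

theorem BruhatStep.le {x y : W} (h : cs.BruhatStep x y) : cs.BruhatLE x y :=
  Relation.ReflTransGen.single h

/-- Reflections have odd length, so multiplying by one changes the parity of the length. -/
theorem BruhatStep.length_eq_or {x y : W} (h : cs.BruhatStep x y) :
    cs.length y = cs.length x + 1 ∨ cs.length x + 3 ≤ cs.length y := by
  obtain ⟨⟨t, ht, rfl⟩, hl⟩ := h
  have h1 := cs.length_mul_mod_two t x
  have h2 := Nat.odd_iff.mp ht.odd_length
  omega

theorem BruhatLE.length_le {x y : W} (h : cs.BruhatLE x y) : cs.length x ≤ cs.length y := by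
  rcases h.eq_or_length_lt with rfl | h
  · exact le_rfl
  · exact h.le

theorem BruhatLE.length_lt {x y : W} (h : cs.BruhatLE x y) (hne : x ≠ y) :
    cs.length x < cs.length y :=
  h.eq_or_length_lt.resolve_left hne

theorem BruhatLE.exists_step {x y : W} (h : cs.BruhatLE x y) (hne : x ≠ y) :
    ∃ z, cs.BruhatStep x z ∧ cs.BruhatLE z y :=
  (Relation.ReflTransGen.cases_head h).resolve_left hne

theorem one_bruhatLE (x : W) : cs.BruhatLE 1 x := by
  induction h : cs.length x generalizing x with
  | zero =>
    rw [cs.length_eq_zero_iff.mp h]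
    exact BruhatLE.refl cs 1
  | succ n ih =>
    have hx : x ≠ 1 := by
      rintro rfl
      simp at h
    obtain ⟨i, hi⟩ := cs.exists_leftDescent_of_ne_one hx
    have hl := cs.isLeftDescent_iff.mp hi
    refine (ih (cs.simple i * x) (by omega)).trans (BruhatStep.le ⟨⟨cs.simple i,
      cs.isReflection_simple i, ?_⟩, hi⟩)
    rw [simple_mul_simple_cancel_left]

/-- The chain property of the Bruhat order. -/
theorem BruhatLE.exists_step_length_eq {x y : W} (h : cs.BruhatLE x y) (hne : x ≠ y) :
    ∃ z, cs.BruhatStep x z ∧ cs.length z = cs.length x + 1 ∧ cs.BruhatLE z y := by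
  obtain ⟨z, hxz, hzy⟩ := h.exists_step hne
  induction hn : cs.length z using Nat.strong_induction_on generalizing z with
  | _ n ih =>
  rcases hxz.length_eq_or with hl | hl
  · exact ⟨z, hxz, hl, hzy⟩
  · obtain ⟨a, a', b, b', -, -, hxa, -, hab, -, -, -, hbz, -⟩ := hxz.exists_hexagon hl
    exact ih _ (by have := hab.2; have := hbz.2; omega) a hxa
      ((hab.le.trans hbz.le).trans hzy) rfl

/-- An order-reversing bijection between Bruhat intervals reverses the edges of the Bruhat
graphs. -/
theorem BruhatStep.of_antiEquiv {u w : W} {u' w' : W'}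
    (e : cs.BruhatInterval u w ≃ cs'.BruhatInterval u' w')
    (he : ∀ p q, cs.BruhatLE p.val q.val ↔ cs'.BruhatLE (e q).val (e p).val)
    {p q : cs.BruhatInterval u w} (h : cs.BruhatStep p.val q.val) :
    cs'.BruhatStep (e q).val (e p).val := by
  induction hn : cs.length q.val - cs.length p.val using Nat.strong_induction_on
    generalizing p q with
  | _ n ih =>
  rcases h.length_eq_or with hl | hl
  -- With gap one nothing lies strictly between `p` and `q`, so the first step of a chain from the
  -- image of `q` already reaches the image of `p`.
  · have hne : (e q).val ≠ (e p).val := by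
      intro h'
      have : p = q := (e.injective (BruhatInterval.ext h')).symm
      rw [this] at hl
      omega
    obtain ⟨z, hz, hzp⟩ := ((he p q).mp h.le).exists_step hne
    obtain ⟨r, hr⟩ := e.surjective
      ⟨z, (e q).left_le.trans hz.le, hzp.trans (e p).le_right⟩
    have hrz : (e r).val = z := by rw [hr]
    rw [← hrz] at hz hzp
    have h1 := (he p r).mpr hzp
    have h2 := (he r q).mpr hz.le
    by_cases hpr : p = r
    · rwa [hpr]
    · exfalso
      have h3 := h1.length_lt fun h' => hpr (BruhatInterval.ext h')
      have h4 := h2.length_lt fun h' => by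
        rw [BruhatInterval.ext h'] at hz
        exact lt_irrefl _ hz.2
      omega
  · obtain ⟨a, a', b, b', haa, hbb, hpa, hpa', hab, hab', ha'b, ha'b', hbq, hbq'⟩ :=
      h.exists_hexagon hl
    obtain ⟨A, hA⟩ : ∃ A : cs.BruhatInterval u w, A.val = a :=
      ⟨⟨a, p.left_le.trans hpa.le, (hab.le.trans hbq.le).trans q.le_right⟩, rfl⟩
    obtain ⟨A', hA'⟩ : ∃ A : cs.BruhatInterval u w, A.val = a' :=
      ⟨⟨a', p.left_le.trans hpa'.le, (ha'b.le.trans hbq.le).trans q.le_right⟩, rfl⟩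
    obtain ⟨C, hC⟩ : ∃ A : cs.BruhatInterval u w, A.val = b :=
      ⟨⟨b, p.left_le.trans (hpa.le.trans hab.le), hbq.le.trans q.le_right⟩, rfl⟩
    obtain ⟨C', hC'⟩ : ∃ A : cs.BruhatInterval u w, A.val = b' :=
      ⟨⟨b', p.left_le.trans (hpa.le.trans hab'.le), hbq'.le.trans q.le_right⟩, rfl⟩
    subst hA hA' hC hC'
    have l1 := hpa.2
    have l2 := hpa'.2
    have l3 := hab.2
    have l4 := hab'.2
    have l5 := ha'b.2
    have l6 := ha'b'.2
    have l7 := hbq.2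
    have l8 := hbq'.2
    exact bruhatStep_of_hexagon
      (fun h' => hbb (congrArg _ (e.injective (BruhatInterval.ext h'))))
      (fun h' => haa (congrArg _ (e.injective (BruhatInterval.ext h'))))
      (ih _ (by omega) hbq rfl) (ih _ (by omega) hbq' rfl)
      (ih _ (by omega) hab rfl) (ih _ (by omega) ha'b rfl)
      (ih _ (by omega) hab' rfl) (ih _ (by omega) ha'b' rfl)
      (ih _ (by omega) hpa rfl) (ih _ (by omega) hpa' rfl)

theorem bruhatStep_iff_of_antiEquiv {u w : W} {u' w' : W'}
    (e : cs.BruhatInterval u w ≃ cs'.BruhatInterval u' w')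
    (he : ∀ p q, cs.BruhatLE p.val q.val ↔ cs'.BruhatLE (e q).val (e p).val)
    (p q : cs.BruhatInterval u w) :
    cs.BruhatStep p.val q.val ↔ cs'.BruhatStep (e q).val (e p).val := by
  refine ⟨BruhatStep.of_antiEquiv e he, fun h => ?_⟩
  have := BruhatStep.of_antiEquiv e.symm (fun p q => by
    rw [he, e.apply_symm_apply, e.apply_symm_apply]) h
  rwa [e.symm_apply_apply, e.symm_apply_apply] at this

/-- An order-reversing bijection between a Bruhat interval and a lower interval turns colength
into length. -/
theorem length_add_of_antiEquiv {u w : W} {x : W'}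
    (e : cs.BruhatInterval u w ≃ cs'.BruhatInterval 1 x)
    (he : ∀ p q, cs.BruhatLE p.val q.val ↔ cs'.BruhatLE (e q).val (e p).val)
    (p : cs.BruhatInterval u w) :
    cs'.length (e p).val + cs.length p.val = cs.length w := by
  induction hn : cs.length w - cs.length p.val generalizing p with
  | zero =>
    have hpw : p.val = w := by
      by_contra hne
      have := p.le_right.length_lt hne
      omega
    have h1 : (e p).val = 1 := by
      obtain ⟨r, hr⟩ := e.surjective ⟨1, BruhatLE.refl cs' 1, one_bruhatLE x⟩
      have := (he r p).mp (by rw [hpw]; exact r.le_right)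
      rw [hr] at this
      exact this.antisymm (one_bruhatLE _)
    rw [h1, hpw, length_one, zero_add]
  | succ n ih =>
    have hne : p.val ≠ w := by
      intro h
      rw [h] at hn
      omega
    obtain ⟨q, hpq, hl, hqw⟩ := p.le_right.exists_step_length_eq hne
    obtain ⟨q, rfl⟩ : ∃ A : cs.BruhatInterval u w, A.val = q :=
      ⟨⟨q, p.left_le.trans hpq.le, hqw⟩, rfl⟩
    have hq := ih q (by omega)
    have hstep := BruhatStep.of_antiEquiv e he hpq
    rcases hstep.length_eq_or with h | h
    · omega
    · exfalso
      -- A gap of three or more would put `a` strictly between the images, and its preimage strictly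
      -- between `p` and its cover `q`.
      obtain ⟨a, -, b, -, -, -, hqa, -, hab, -, -, -, hbp, -⟩ := hstep.exists_hexagon h
      have hap := hab.le.trans hbp.le
      obtain ⟨r, hr⟩ := e.surjective ⟨a, one_bruhatLE a, hap.trans (e p).le_right⟩
      have hra : (e r).val = a := by rw [hr]
      rw [← hra] at hqa hap hab
      have h1 := (he p r).mpr hap
      have h2 := (he r q).mpr hqa.le
      have h3 := h1.length_lt fun h' => by
        rw [BruhatInterval.ext h'] at hbp
        exact lt_asymm hab.2 hbp.2
      have h4 := h2.length_lt fun h' => by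
        rw [BruhatInterval.ext h'] at hqa
        exact lt_irrefl _ hqa.2
      omega

/-- An element `z` of a Coxeter group has exactly `ℓ(z)` incoming edges in the Bruhat graph. -/
theorem ncard_setOf_bruhatStep (z : W) : {v | cs.BruhatStep v z}.ncard = cs.length z := by
  have himage : {v | cs.BruhatStep v z} =
      (fun r => z * cs.rootReflection r) '' cs.inversions {d | cs.IsRoot d} z := by
    ext v
    constructor
    · intro h
      obtain ⟨r, hr, hr0, hv, rfl⟩ := bruhatStep_iff.mp h
      refine ⟨r, ⟨hr, hr0, ?_⟩, ?_⟩
      · rw [geomRep_mul_apply, hr.rootReflection_self, map_neg, map_neg]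
        linarith
      · simp only [mul_assoc, hr.mul_self, mul_one]
    · rintro ⟨r, ⟨hr, hr0, hz⟩, rfl⟩
      have hr : cs.IsRoot r := hr
      refine bruhatStep_iff.mpr ⟨r, hr, hr0, ?_, ?_⟩
      · rw [geomRep_mul_apply, hr.rootReflection_self, map_neg, map_neg]
        linarith
      · simp only [mul_assoc, hr.mul_self, mul_one]
  rw [himage, Set.InjOn.ncard_image, ← relLength_isRoot, relLength]
  rintro r ⟨hr, hr0, -⟩ r' ⟨hr', hr0', -⟩ h
  exact IsRoot.eq_of_rootReflection_eq hr' hr hr0' hr0 (mul_left_cancel h).symm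

/-- The neighbours of `y` in `[y,w]` are all above it, and they correspond to the sources of all
edges into its image: these sources lie below `x`, hence in the interval. Their number is the length
of the image, which is the colength of `y`. -/
theorem isRationallySmooth_of_antiEquiv {u w : W} {x : W'}
    (e : cs.BruhatInterval u w ≃ cs'.BruhatInterval 1 x)
    (he : ∀ p q, cs.BruhatLE p.val q.val ↔ cs'.BruhatLE (e q).val (e p).val) :
    cs.IsRationallySmooth u w := by
  intro y
  have hlen := length_add_of_antiEquiv e he y
  suffices h : cs.bruhatDegree y.val w ⟨y.val, BruhatLE.refl cs y.val, y.le_right⟩ =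
      {v | cs'.BruhatStep v (e y).val}.ncard by
    rw [h, ncard_setOf_bruhatStep]
    omega
  have hiff := bruhatStep_iff_of_antiEquiv e he
  have hnbr : ∀ v : cs.BruhatInterval y.val w,
      v ∈ (cs.intervalBruhatGraph y.val w).neighborSet
        ⟨y.val, BruhatLE.refl cs y.val, y.le_right⟩ ↔ cs.BruhatStep y.val v.val := by
    intro v
    refine ⟨fun h => Or.resolve_right h fun h' => ?_, Or.inl⟩
    exact absurd h'.2 v.left_le.length_le.not_gt
  refine Set.ncard_congr
    (fun v _ => (e ⟨v.val, y.left_le.trans v.left_le, v.le_right⟩).val) ?_ ?_ ?_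
  · intro v hv
    exact (hiff y ⟨v.val, _, _⟩).mp ((hnbr v).mp hv)
  · intro v v' _ _ h
    have := e.injective (BruhatInterval.ext h)
    exact BruhatInterval.ext (BruhatInterval.mk.inj this)
  · intro z hz
    have hz : cs'.BruhatStep z (e y).val := hz
    obtain ⟨r, hr⟩ := e.surjective ⟨z, one_bruhatLE z, hz.le.trans (e y).le_right⟩
    have hrz : (e r).val = z := by rw [hr]
    have hyr : cs.BruhatStep y.val r.val := (hiff y r).mpr (by rwa [hrz])
    exact ⟨⟨r.val, hyr.le, r.le_right⟩, (hnbr _).mpr hyr, hrz⟩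

end CoxeterSystem

theorem mainTheorem3 {B W : Type*} [Group W] {M : CoxeterMatrix B} (cs : CoxeterSystem M W)
    (hW : cs.IsWeyl) (u w : W) (huw : cs.BruhatLT u w)
    {B' W' : Type*} [Group W'] {M' : CoxeterMatrix B'} (cs' : CoxeterSystem M' W') (x : W')
    (hiso : Nonempty ((cs.BruhatInterval u w)ᵒᵈ ≃o cs'.BruhatInterval 1 x)) :
    cs.IsRationallySmooth u w := by
  obtain ⟨φ⟩ := hiso
  exact CoxeterSystem.isRationallySmooth_of_antiEquiv (OrderDual.toDual.trans φ.toEquiv)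
    fun p q => (φ.le_iff_le (x := OrderDual.toDual q) (y := OrderDual.toDual p)).symm
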